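/- Let $M=(\mathcal S,\mathcal A,R,T,\gamma)$ be a Markov decision process with finite state and action spaces and discount factor $\gamma\in[0,1)$, such that each reward law $R(s,a)$ is carried by a bounded interval and has a distribution function with only finitely many discontinuities. Let $\pi$ be a (stochastic) policy, and let $Z^\pi(s,a)$ be the law of the return $\sum_{t\ge 0}\gamma^tR(s_t,a_t)$ of the trajectory started at $(s_0,a_0)=(s,a)$ and following $\pi$. For a probability law $\eta$ on $\mathbb R$ with bounded support let $F_\eta^{-1}(\tau)=\inf\{x:\tau\le F_\eta(x)\}$ be its quantile function and $E_\eta$ its expectile function: $E_\eta(\tau)$ is the minimizer, over $e$ in the convex hull of the support of $\eta$, of $\mathbb E_{z\sim\eta}\big[(\tau 1_{z>e}+(1-\tau)1_{z\le e})(z-e)^2\big]$ for $\tau\in[0,1]$ (so $E_\eta(0)$ and $E_\eta(1)$ are the end points of that hull), and $E_\eta(\tau)=E_\eta(1)$ for $\tau>1$. Put $\mathcal M_\eta=E_\eta^{-1}\circ F_\eta^{-1}$, where $E_\eta^{-1}(x)=\inf\{\tau\in[0,1]:x\le E_\eta(\tau)\}$. For $K\ge1$ and $1\le k\le K$ let $\tau_k=\frac{2k-1}{2K}$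 and $$s_k(\eta)=s_k^K(\eta)=E_\eta\!\left(\frac{2\lfloor K\,\mathcal M_\eta(\tau_k)\rfloor+1}{2K}\right),\qquad \Pi_{\mathcal M}\eta=\Pi_{\mathcal M}^K\eta=\frac1K\sum_{k=1}^K\delta_{s_k(\eta)} .$$ Let $(\mathcal T^\pi Z)(s,a)$ be the law of $R(s,a)+\gamma Z(s',a')$ with $s'\sim T(\cdot\mid s,a)$, $a'\sim\pi(\cdot\mid s')$, where the reward is independent of $(s',a')$ and of the sample of $Z(s',a')$. Then the mapped expectile statistics are approximately Bellman-closed: for every $K$ let $Z_0^K$ be an arbitrary family of probability laws with bounded support indexed by $\mathcal S\times\mathcal A$, and let $Z_n^K=(\Pi_{\mathcal M}\mathcal T^\pi)^nZ_0^K$. Then $$\lim_{K\to\infty}\ \limsup_{n\to\infty}\ \sup_{(s,a)\in\mathcal S\times\mathcal A}\ \frac1K\sum_{k=1}^K\left|s_k(Z^\pi(s,a))-\hat s_k^{\,n}(s,a)\right|=0,$$ both when $\hat s_k^{\,n}(s,a)=s_k(Z_n^K(s,a))$ and when $\hat s_k^{\,n}(s,a)=s_k\big((\mathcal T^\pi Z_n^K)(s,a)\big)$,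 the latter being the $K$ atoms of $Z_{n+1}^K(s,a)$. In particular this holds, without the limit in $n$, when $Z_0^K$ is a fixed point of $\Pi_{\mathcal M}\mathcal T^\pi$. -/

import Mathlib

open MeasureTheory ProbabilityTheory Filter Topology Set
open scoped ENNReal

noncomputable section

/-! ### Quantiles, expectiles and mapped expectiles of a law on the real line -/

/-- The law `η` takes its values in some compact interval. -/
def HasBoundedSupport (η : Measure ℝ) : Prop :=
  ∃ a b : ℝ, ∀ᵐ z ∂η, z ∈ Icc a b

/-- The distribution function of `η` has finitely many discontinuities. -/
def HasFinitelyManyDiscontinuities (η : Measure ℝ) : Prop :=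
  {x : ℝ | ¬ ContinuousAt (cdf η) x}.Finite

/-- The quantile function `F_η⁻¹ : τ ↦ inf {x | τ ≤ F_η x}`. -/
def quantile (η : Measure ℝ) (τ : ℝ) : ℝ :=
  sInf {x : ℝ | τ ≤ cdf η x}

/-- The asymmetric squared loss
`E_{z ∼ η} [(τ 1_{z > e} + (1 - τ) 1_{z ≤ e}) (z - e)²]`. -/
def expectileLoss (η : Measure ℝ) (τ e : ℝ) : ℝ :=
  ∫ z, (if e < z then τ else 1 - τ) * (z - e) ^ 2 ∂η

/-- The set of minimizers of the asymmetric squared loss over the convex hull of the support.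
For `0 < τ < 1` the unique minimizer over all of `ℝ` lies in that hull, so the restriction changes
nothing; at `τ = 0` and `τ = 1` (where every point below, respectively above, the support is also a
minimizer over `ℝ`) it singles out the left and right end of the support; a level `τ > 1` gives
again the right end, that is, the expectile function is continued by its value at `1`. -/
def expectileSet (η : Measure ℝ) (τ : ℝ) : Set ℝ :=
  {e | e ∈ convexHull ℝ η.support ∧
    ∀ e' ∈ convexHull ℝ η.support, expectileLoss η τ e ≤ expectileLoss η τ e'}

/-- The expectile function `E_η`. For a boundedly supported probability law `expectileSet η τ` is
a singleton, and `sInf` picks its element. -/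
def expectile (η : Measure ℝ) (τ : ℝ) : ℝ :=
  sInf (expectileSet η τ)

/-- The inverse of the expectile function `E_η : [0,1] → ℝ`; for a point mass, where `E_η` is
constant, this is the generalized inverse. -/
def expectileInv (η : Measure ℝ) (x : ℝ) : ℝ :=
  sInf {τ : ℝ | τ ∈ Icc (0 : ℝ) 1 ∧ x ≤ expectile η τ}

/-- The mapper `M_η = E_η⁻¹ ∘ F_η⁻¹` from quantile levels to expectile levels. -/
def mapper (η : Measure ℝ) (τ : ℝ) : ℝ :=
  expectileInv η (quantile η τ)

/-- The levels `τ_k = (2k - 1) / (2K)`, for `k = 1, …, K`. -/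
def level (K k : ℕ) : ℝ :=
  (2 * (k : ℝ) - 1) / (2 * (K : ℝ))

/-- The mapped expectile statistic `s_k(η) = E_η ((2 ⌊K M_η(τ_k)⌋ + 1) / (2K))`. -/
def mappedExpectile (K k : ℕ) (η : Measure ℝ) : ℝ :=
  expectile η ((2 * (⌊(K : ℝ) * mapper η (level K k)⌋ : ℝ) + 1) / (2 * (K : ℝ)))

/-- The projection `Π_M η`, the uniform mixture of the point masses at the `K` statistics. -/
def mappedProjection (K : ℕ) (η : Measure ℝ) : Measure ℝ :=
  (K : ℝ≥0∞)⁻¹ • ∑ k ∈ Finset.Icc 1 K, Measure.dirac (mappedExpectile K k η)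

/-! ### Markov decision processes, policies and returns -/

/-- A Markov decision process with state space `S` and action space `A`: the law of the random
reward of a state-action pair, the law of the next state, and the discount factor. -/
structure MDP (S A : Type*) where
  reward : S × A → ProbabilityMeasure ℝ
  transition : S × A → PMF S
  discount : ℝ

namespace MDP

variable {S A : Type*}

/-- The law of the next state-action pair `(s', a')`, with `s' ∼ T(· | s, a)` and
`a' ∼ π(· | s')`. -/
def nextPair (M : MDP S A) (π : S → PMF A) (x : S × A) : PMF (S × A) :=
  (M.transition x).bind fun s' => (π s').map fun a' => (s', a')

/-- The distributional Bellman operator: `(T^π Z)(s, a)` is the law of `R(s, a) + γ Z(s', a')`,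
where the reward, the next pair `(s', a')` and the sample of `Z` at it are drawn independently. -/
def bellman [Fintype S] [Fintype A] (M : MDP S A) (π : S → PMF A)
    (Z : S × A → Measure ℝ) (x : S × A) : Measure ℝ :=
  ∑ y : S × A, M.nextPair π x y •
    ((M.reward x : Measure ℝ).prod (Z y)).map fun p => p.1 + M.discount * p.2

/-- The projected operator `Π_M T^π`. -/
def projectedBellman [Fintype S] [Fintype A] (M : MDP S A) (π : S → PMF A) (K : ℕ)
    (Z : S × A → Measure ℝ) (x : S × A) : Measure ℝ :=
  mappedProjection K (M.bellman π Z x)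

section Return

variable [Fintype S] [Fintype A] [MeasurableSpace S] [MeasurableSpace A]
  [DiscreteMeasurableSpace S] [DiscreteMeasurableSpace A]

/-- The reward laws as a Markov kernel. -/
def rewardKernel (M : MDP S A) : Kernel (S × A) ℝ :=
  Kernel.ofFunOfCountable fun x => (M.reward x : Measure ℝ)

instance (M : MDP S A) : IsMarkovKernel M.rewardKernel :=
  ⟨fun x => inferInstanceAs (IsProbabilityMeasure (M.reward x : Measure ℝ))⟩

/-- The law of the next state-action pair as a Markov kernel. -/
def nextPairKernel (M : MDP S A) (π : S → PMF A) : Kernel (S × A) (S × A) :=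
  Kernel.ofFunOfCountable fun x => (M.nextPair π x).toMeasure

instance (M : MDP S A) (π : S → PMF A) : IsMarkovKernel (M.nextPairKernel π) :=
  ⟨fun x => inferInstanceAs (IsProbabilityMeasure (M.nextPair π x).toMeasure)⟩

/-- One step of the process `((s_t, a_t), R_t)`: draw the next state-action pair, then the reward
at that pair. -/
def stepKernel (M : MDP S A) (π : S → PMF A) : Kernel ((S × A) × ℝ) ((S × A) × ℝ) :=
  (M.nextPairKernel π ⊗ₖ Kernel.prodMkLeft (S × A) M.rewardKernel).comap Prod.fst measurable_fst

instance (M : MDP S A) (π : S → PMF A) : IsMarkovKernel (M.stepKernel π) := by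
  unfold stepKernel
  infer_instance

/-- The law of the trajectory `((s_t, a_t), R_t)_{t ≥ 0}` that starts at the pair `x` and
follows the policy `π`. -/
def trajectory (M : MDP S A) (π : S → PMF A) (x : S × A) :
    Measure (ℕ → (S × A) × ℝ) :=
  Kernel.trajMeasure (X := fun _ => (S × A) × ℝ)
    ((Measure.dirac x).prod (M.reward x : Measure ℝ))
    fun n => (M.stepKernel π).comap (fun h => h ⟨n, Finset.mem_Iic.2 le_rfl⟩)
      (measurable_pi_apply _)

/-- The true return distribution `Z^π(s, a)`: the law of `∑ γ^t R_t` along the trajectory. -/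
def returnLaw (M : MDP S A) (π : S → PMF A) (x : S × A) : Measure ℝ :=
  (M.trajectory π x).map fun ω => ∑' t : ℕ, M.discount ^ t * (ω t).2

/-- For arrays of statistics `ŝ_k(s, a)`, the number
`sup_{(s,a)} (1/K) ∑_{k=1}^K |s_k(Z^π(s, a)) - ŝ_k(s, a)|`. -/
def statisticsError (M : MDP S A) (π : S → PMF A) (K : ℕ) (sHat : ℕ → S × A → ℝ) : ℝ≥0∞ :=
  ⨆ x : S × A, ENNReal.ofReal
    ((1 / (K : ℝ)) * ∑ k ∈ Finset.Icc 1 K, |mappedExpectile K k (M.returnLaw π x) - sHat k x|)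

end Return

end MDP

end

noncomputable section

/-! ### Partial moments and the expectile function -/

/-! Write U(e) = E(e - z)₊ and V(e) = E(z - e)₊. The first-order condition of the asymmetric loss is
τ V(e) = (1 - τ) U(e), so that E_η⁻¹ = U / (U + V). Without the rounding of the level, s_k would be
exactly the quantile q_k of level τ_k, and the usual Wasserstein-1 argument would apply: the Bellman
operator is a γ-contraction and the projection onto K quantiles costs O(1/K). The question is what a
perturbation of the level by at most 1/(2K) does to the expectile.

If it carries the expectile above q_k by more than ε, then τ_k ε V(q_k) ≤ L²/(2K), where L bounds
the length of the hull; below q_k the same holds with 1 - τ_k and U (`displacement_bound`). So the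
displacement is small once U(q_k) and V(q_k) are bounded below. This may fail for a law with almost
no mass near an end of its hull, where a tiny change of level moves the expectile far. Hence
`eventually_meanDisplacement_le` asks for mass p near both ends of an interval carrying the law.

The core is to have this for the iterates, with p independent of K and n. Let l, u solve the Bellman
equations for the smallest and the largest return. The supports of the iterates shrink into [l - δ,
u + δ]. A Bellman step turns "mass p within D of the ends" into "mass κp within γD + ε"
(`IsExtremal.exists_chargesEnds_bellman`), and the projection keeps a fixed share of each tail at
the price of another ε, with no assumption on the ends (`exists_eventually_card_ge`). From a trivial
initial margin, finitely many rounds, their number independent of K, reach any margin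
(`forall_pos_of_contraction`).

The distance c of the iterates to the return law is then improved to γc + ε by each round, and so is
eventually below any bound. Finally s_k of two laws are compared through their quantiles, whose mean
gap is the Wasserstein distance up to O(1/K). -/

/-- The lower partial moment `E_{z ∼ η} (e - z)₊`. -/
def lowerMoment (η : Measure ℝ) (e : ℝ) : ℝ := ∫ z, max (e - z) 0 ∂η

/-- The upper partial moment `E_{z ∼ η} (z - e)₊`. -/
def upperMoment (η : Measure ℝ) (e : ℝ) : ℝ := ∫ z, max (z - e) 0 ∂η

/-- The interval `[a, b]` is the convex hull of the support of `η`. -/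
structure IsHull (η : Measure ℝ) (a b : ℝ) : Prop where
  ae_mem : ∀ᵐ z ∂η, z ∈ Icc a b
  pos_Iio : ∀ e, a < e → 0 < η (Iio e)
  pos_Ioi : ∀ e, e < b → 0 < η (Ioi e)
  convexHull_eq : convexHull ℝ η.support = Icc a b
  le : a ≤ b

lemma support_subset_Icc {η : Measure ℝ} {a b : ℝ} (h : ∀ᵐ z ∂η, z ∈ Icc a b) :
    η.support ⊆ Icc a b :=
  Measure.support_subset_of_isClosed isClosed_Icc h

lemma exists_isHull {η : Measure ℝ} [IsProbabilityMeasure η] (h : HasBoundedSupport η) :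
    ∃ a b, IsHull η a b := by
  obtain ⟨a', b', hab⟩ := h
  have hsub := support_subset_Icc hab
  have hne : η.support.Nonempty := Measure.nonempty_support (IsProbabilityMeasure.ne_zero η)
  have hc : IsCompact η.support := isCompact_Icc.of_isClosed_subset Measure.isClosed_support hsub
  obtain ⟨a, ha, hamin⟩ := hc.exists_isLeast hne
  obtain ⟨b, hb, hbmax⟩ := hc.exists_isGreatest hne
  have hs : η.support ⊆ Icc a b := fun z hz => ⟨hamin hz, hbmax hz⟩
  have hab' : a ≤ b := hamin hb
  refine ⟨a, b, ?_, ?_, ?_, ?_, hab'⟩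
  · filter_upwards [Measure.support_mem_ae (μ := η)] with z hz using hs hz
  · intro e he
    exact (Measure.mem_support_iff_forall a).1 ha _ (Iio_mem_nhds he)
  · intro e he
    exact (Measure.mem_support_iff_forall b).1 hb _ (Ioi_mem_nhds he)
  · refine (convexHull_min hs (convex_Icc a b)).antisymm ?_
    rw [← segment_eq_Icc hab']
    exact segment_subset_convexHull ha hb

lemma integrable_of_continuous {η : Measure ℝ} [IsFiniteMeasure η] {a b : ℝ}
    (h : ∀ᵐ z ∂η, z ∈ Icc a b) {f : ℝ → ℝ} (hf : Continuous f) : Integrable f η := by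
  have := (hf.continuousOn (s := Icc a b)).integrableOn_compact (μ := η) isCompact_Icc
  rwa [IntegrableOn, Measure.restrict_eq_self_of_ae_mem h] at this

section Moments

variable {η : Measure ℝ} {a b : ℝ}

lemma lowerMoment_nonneg (e : ℝ) : 0 ≤ lowerMoment η e :=
  integral_nonneg fun _ => le_max_right _ _

lemma upperMoment_nonneg (e : ℝ) : 0 ≤ upperMoment η e :=
  integral_nonneg fun _ => le_max_right _ _

lemma IsHull.lowerMoment_left (h : IsHull η a b) : lowerMoment η a = 0 := by
  rw [lowerMoment]
  refine integral_eq_zero_of_ae ?_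
  filter_upwards [h.ae_mem] with z hz
  exact max_eq_right (by linarith [hz.1])

lemma IsHull.upperMoment_right (h : IsHull η a b) : upperMoment η b = 0 := by
  rw [upperMoment]
  refine integral_eq_zero_of_ae ?_
  filter_upwards [h.ae_mem] with z hz
  exact max_eq_right (by linarith [hz.2])

lemma IsHull.expectile_eq_of_forall_lt (h : IsHull η a b) {τ e : ℝ} (he : e ∈ Icc a b)
    (hlt : ∀ e' ∈ Icc a b, e' ≠ e → expectileLoss η τ e < expectileLoss η τ e') :
    expectile η τ = e := by
  have : expectileSet η τ = {e} := by
    ext x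
    simp only [expectileSet, h.convexHull_eq, mem_ofPred_eq, mem_singleton_iff]
    constructor
    · rintro ⟨hx, hmin⟩
      by_contra hne
      exact (hlt x hx hne).not_ge (hmin e he)
    · rintro rfl
      refine ⟨he, fun e' he' => ?_⟩
      by_cases hne : e' = x
      · rw [hne]
      · exact (hlt e' he' hne).le
  rw [expectile, this, csInf_singleton]

variable [IsProbabilityMeasure η]

lemma integrable_lower (h : ∀ᵐ z ∂η, z ∈ Icc a b) (e : ℝ) :
    Integrable (fun z => max (e - z) 0) η :=
  integrable_of_continuous h (by fun_prop)

lemma integrable_upper (h : ∀ᵐ z ∂η, z ∈ Icc a b) (e : ℝ) :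
    Integrable (fun z => max (z - e) 0) η :=
  integrable_of_continuous h (by fun_prop)

lemma lowerMoment_mono (h : ∀ᵐ z ∂η, z ∈ Icc a b) : Monotone (lowerMoment η) := fun e e' hee =>
  integral_mono (integrable_lower h e) (integrable_lower h e') fun z =>
    max_le_max (by dsimp; linarith) le_rfl

lemma upperMoment_anti (h : ∀ᵐ z ∂η, z ∈ Icc a b) : Antitone (upperMoment η) := fun e e' hee =>
  integral_mono (integrable_upper h e') (integrable_upper h e) fun z =>
    max_le_max (by dsimp; linarith) le_rfl

/-- U(x) - V(x) is x minus the mean, so the growth of U and the decay of V share the step exactly.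
-/
lemma lowerMoment_sub_upperMoment (h : ∀ᵐ z ∂η, z ∈ Icc a b) (e e' : ℝ) :
    lowerMoment η e' - lowerMoment η e + upperMoment η e - upperMoment η e' = e' - e := by
  have h1 : ∀ x : ℝ, lowerMoment η x - upperMoment η x = x - ∫ z, z ∂η := by
    intro x
    rw [lowerMoment, upperMoment, ← integral_sub (integrable_lower h x) (integrable_upper h x)]
    have : ∀ z : ℝ, max (x - z) 0 - max (z - x) 0 = x - z := by
      intro z
      rcases le_total x z with hz | hz
      · rw [max_eq_right (by linarith), max_eq_left (by linarith)]; ring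
      · rw [max_eq_left (by linarith), max_eq_right (by linarith)]; ring
    simp_rw [this]
    rw [integral_sub (integrable_const _) (integrable_of_continuous h continuous_id')]
    simp
  linarith [h1 e, h1 e']

lemma lowerMoment_add_upperMoment_le (h : ∀ᵐ z ∂η, z ∈ Icc a b) {e : ℝ} (he : e ∈ Icc a b) :
    lowerMoment η e + upperMoment η e ≤ b - a := by
  rw [lowerMoment, upperMoment, ← integral_add (integrable_lower h e) (integrable_upper h e)]
  calc _ ≤ ∫ _, (b - a) ∂η := by
        refine integral_mono_ae ((integrable_lower h e).add (integrable_upper h e))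
          (integrable_const _) ?_
        filter_upwards [h] with z hz
        simp only [mem_Icc] at he hz
        rcases le_total e z with hz' | hz'
        · rw [max_eq_right (by linarith), max_eq_left (by linarith)]; linarith
        · rw [max_eq_left (by linarith), max_eq_right (by linarith)]; linarith
    _ = b - a := by simp

/-- Every z ≤ x contributes the full e - x to the increment, and no z contributes negatively. -/
lemma le_lowerMoment_sub (h : ∀ᵐ z ∂η, z ∈ Icc a b) {x e : ℝ} (hxe : x ≤ e) :
    η.real (Iic x) * (e - x) ≤ lowerMoment η e - lowerMoment η x := by
  rw [lowerMoment, lowerMoment, ← integral_sub (integrable_lower h e) (integrable_lower h x),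
    ← smul_eq_mul, ← integral_indicator_const _ measurableSet_Iic]
  refine integral_mono ((integrable_const _).indicator measurableSet_Iic)
    ((integrable_lower h e).sub (integrable_lower h x)) fun z => ?_
  by_cases hz : z ≤ x
  · rw [indicator_of_mem (show z ∈ Iic x from hz)]
    dsimp only
    rw [max_eq_left (by linarith), max_eq_left (by linarith)]; linarith
  · rw [indicator_of_notMem (show z ∉ Iic x from hz)]
    simp only [sub_nonneg]
    exact max_le_max (by linarith) le_rfl

lemma le_upperMoment_sub (h : ∀ᵐ z ∂η, z ∈ Icc a b) {x e : ℝ} (hxe : e ≤ x) :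
    η.real (Ici x) * (x - e) ≤ upperMoment η e - upperMoment η x := by
  rw [upperMoment, upperMoment, ← integral_sub (integrable_upper h e) (integrable_upper h x),
    ← smul_eq_mul, ← integral_indicator_const _ measurableSet_Ici]
  refine integral_mono ((integrable_const _).indicator measurableSet_Ici)
    ((integrable_upper h e).sub (integrable_upper h x)) fun z => ?_
  by_cases hz : x ≤ z
  · rw [indicator_of_mem (show z ∈ Ici x from hz)]
    dsimp only
    rw [max_eq_left (by linarith), max_eq_left (by linarith)]; linarith
  · rw [indicator_of_notMem (show z ∉ Ici x from hz)]
    simp only [sub_nonneg]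
    exact max_le_max (by linarith) le_rfl

lemma mul_le_lowerMoment (h : ∀ᵐ z ∂η, z ∈ Icc a b) {x e : ℝ} (hxe : x ≤ e) :
    η.real (Iic x) * (e - x) ≤ lowerMoment η e :=
  (le_lowerMoment_sub h hxe).trans (by linarith [lowerMoment_nonneg (η := η) x])

lemma mul_le_upperMoment (h : ∀ᵐ z ∂η, z ∈ Icc a b) {x e : ℝ} (hxe : e ≤ x) :
    η.real (Ici x) * (x - e) ≤ upperMoment η e :=
  (le_upperMoment_sub h hxe).trans (by linarith [upperMoment_nonneg (η := η) x])

lemma lowerMoment_le_mul (h : ∀ᵐ z ∂η, z ∈ Icc a b) {x : ℝ} (hx : x ∈ Icc a b) :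
    lowerMoment η x ≤ η.real (Iio x) * (b - a) := by
  rw [lowerMoment, ← smul_eq_mul, ← integral_indicator_const _ measurableSet_Iio]
  refine integral_mono_ae (integrable_lower h x)
    ((integrable_const _).indicator measurableSet_Iio) ?_
  filter_upwards [h] with z hz
  by_cases hzx : z < x
  · rw [indicator_of_mem (show z ∈ Iio x from hzx), max_eq_left (by linarith)]
    linarith [hz.1, hx.2]
  · rw [indicator_of_notMem (show z ∉ Iio x from hzx), max_eq_right (by linarith)]

lemma upperMoment_le_mul (h : ∀ᵐ z ∂η, z ∈ Icc a b) {x : ℝ} (hx : x ∈ Icc a b) :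
    upperMoment η x ≤ η.real (Ioi x) * (b - a) := by
  rw [upperMoment, ← smul_eq_mul, ← integral_indicator_const _ measurableSet_Ioi]
  refine integral_mono_ae (integrable_upper h x)
    ((integrable_const _).indicator measurableSet_Ioi) ?_
  filter_upwards [h] with z hz
  by_cases hzx : x < z
  · rw [indicator_of_mem (show z ∈ Ioi x from hzx), max_eq_left (by linarith)]
    linarith [hz.2, hx.1]
  · rw [indicator_of_notMem (show z ∉ Ioi x from hzx), max_eq_right (by linarith)]

lemma continuous_lowerMoment (h : ∀ᵐ z ∂η, z ∈ Icc a b) : Continuous (lowerMoment η) := by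
  refine LipschitzWith.continuous (K := 1) (LipschitzWith.of_le_add fun e e' => ?_)
  rw [Real.dist_eq]
  rcases le_total e e' with hee | hee
  · linarith [lowerMoment_mono h hee, abs_nonneg (e - e')]
  · linarith [lowerMoment_sub_upperMoment h e' e, upperMoment_anti h hee, le_abs_self (e - e')]

lemma continuous_upperMoment (h : ∀ᵐ z ∂η, z ∈ Icc a b) : Continuous (upperMoment η) := by
  have : upperMoment η = fun e => lowerMoment η e - lowerMoment η 0 + upperMoment η 0 - e := by
    ext e
    linarith [lowerMoment_sub_upperMoment h 0 e]
  rw [this]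
  have := continuous_lowerMoment h
  fun_prop

lemma IsHull.lowerMoment_pos (h : IsHull η a b) {e : ℝ} (he : a < e) : 0 < lowerMoment η e := by
  have h1 := mul_le_lowerMoment h.ae_mem (show (a + e) / 2 ≤ e by linarith)
  have h2 : 0 < η.real (Iic ((a + e) / 2)) :=
    ENNReal.toReal_pos ((h.pos_Iio _ (by linarith)).trans_le (measure_mono Iio_subset_Iic_self)).ne'
      (measure_ne_top _ _)
  exact (mul_pos h2 (by linarith)).trans_le h1

lemma IsHull.upperMoment_pos (h : IsHull η a b) {e : ℝ} (he : e < b) : 0 < upperMoment η e := by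
  have h1 := mul_le_upperMoment h.ae_mem (show e ≤ (e + b) / 2 by linarith)
  have h2 : 0 < η.real (Ici ((e + b) / 2)) :=
    ENNReal.toReal_pos ((h.pos_Ioi _ (by linarith)).trans_le (measure_mono Ioi_subset_Ici_self)).ne'
      (measure_ne_top _ _)
  exact (mul_pos h2 (by linarith)).trans_le h1

lemma integrable_expectileLoss (h : ∀ᵐ z ∂η, z ∈ Icc a b) (τ e : ℝ) :
    Integrable (fun z => (if e < z then τ else 1 - τ) * (z - e) ^ 2) η := by
  have : (fun z => (if e < z then τ else 1 - τ) * (z - e) ^ 2) =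
      fun z => τ * max (z - e) 0 ^ 2 + (1 - τ) * max (e - z) 0 ^ 2 := by
    ext z
    split_ifs with hz
    · rw [max_eq_left (by linarith), max_eq_right (by linarith)]; ring
    · rw [max_eq_right (by linarith), max_eq_left (by linarith)]; ring
  rw [this]
  exact integrable_of_continuous h (by fun_prop)

/-- As a function of the candidate e, the loss at z is C¹ and piecewise quadratic with second
derivatives 2τ and 2(1 - τ), both at least 2m; this is the resulting quadratic lower bound around e.
Integrated, it makes a critical point a strict minimizer. -/
lemma asymmetric_sq_le {τ m z e e' : ℝ} (h1 : m ≤ τ) (h2 : m ≤ 1 - τ) :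
    (if e < z then τ else 1 - τ) * (z - e) ^ 2
      - 2 * (τ * max (z - e) 0 - (1 - τ) * max (e - z) 0) * (e' - e) + m * (e' - e) ^ 2
      ≤ (if e' < z then τ else 1 - τ) * (z - e') ^ 2 := by
  by_cases hz : e < z <;> by_cases hz' : e' < z
  · rw [if_pos hz, if_pos hz', max_eq_left (by linarith), max_eq_right (by linarith)]
    nlinarith [sq_nonneg (e' - e)]
  · rw [if_pos hz, if_neg hz', max_eq_left (by linarith), max_eq_right (by linarith)]
    have hp : 0 ≤ z - e := by linarith
    have hr : 0 ≤ e' - z := by linarith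
    nlinarith [mul_nonneg hp hr, sq_nonneg (z - e), sq_nonneg (e' - z),
      mul_nonneg (sub_nonneg.2 h1) (sq_nonneg (z - e)),
      mul_nonneg (sub_nonneg.2 h2) (sq_nonneg (e' - z)),
      mul_nonneg (sub_nonneg.2 h1) (mul_nonneg hp hr)]
  · rw [if_neg hz, if_pos hz', max_eq_right (by linarith), max_eq_left (by linarith)]
    have hp : 0 ≤ e - z := by linarith
    have hr : 0 ≤ z - e' := by linarith
    nlinarith [mul_nonneg hp hr, sq_nonneg (z - e), sq_nonneg (e' - z),
      mul_nonneg (sub_nonneg.2 h2) (sq_nonneg (z - e)),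
      mul_nonneg (sub_nonneg.2 h1) (sq_nonneg (e' - z)),
      mul_nonneg (sub_nonneg.2 h2) (mul_nonneg hp hr)]
  · rw [if_neg hz, if_neg hz', max_eq_right (by linarith), max_eq_left (by linarith)]
    nlinarith [sq_nonneg (e' - e)]

lemma expectileLoss_le (h : ∀ᵐ z ∂η, z ∈ Icc a b) {τ m : ℝ} (h1 : m ≤ τ)
    (h2 : m ≤ 1 - τ) (e e' : ℝ) :
    expectileLoss η τ e - 2 * (τ * upperMoment η e - (1 - τ) * lowerMoment η e) * (e' - e)
      + m * (e' - e) ^ 2 ≤ expectileLoss η τ e' := by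
  have i1 := integrable_expectileLoss h τ e
  have i2 : Integrable (fun z => 2 * (τ * max (z - e) 0 - (1 - τ) * max (e - z) 0) * (e' - e)) η :=
    integrable_of_continuous h (by fun_prop)
  have i3 : Integrable (fun z => τ * max (z - e) 0) η := (integrable_upper h e).const_mul _
  have i4 : Integrable (fun z => (1 - τ) * max (e - z) 0) η := (integrable_lower h e).const_mul _
  have := integral_mono ((i1.sub i2).add (integrable_const (m * (e' - e) ^ 2)))
    (integrable_expectileLoss h τ e') fun z => asymmetric_sq_le (e' := e') h1 h2
  have e1 := integral_add (i1.sub i2) (integrable_const (m * (e' - e) ^ 2))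
  simp only [Pi.sub_apply] at e1
  simp only [Pi.add_apply, Pi.sub_apply] at this
  rw [e1, integral_sub i1 i2, integral_mul_const,
    integral_const_mul, integral_sub i3 i4, integral_const_mul, integral_const_mul] at this
  simpa [expectileLoss, lowerMoment, upperMoment] using this

end Moments

/-! ### The first-order condition and the inverse of the expectile function -/

section Expectile

variable {η : Measure ℝ} {a b : ℝ} [IsProbabilityMeasure η]

lemma IsHull.expectile_eq (h : IsHull η a b) {τ e : ℝ} (he : e ∈ Icc a b) (hτ : τ ∈ Ioo (0 : ℝ) 1)
    (h0 : τ * upperMoment η e = (1 - τ) * lowerMoment η e) : expectile η τ = e := by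
  refine h.expectile_eq_of_forall_lt he fun e' _ hne => ?_
  have hm : 0 < min τ (1 - τ) := lt_min hτ.1 (by linarith [hτ.2])
  have := expectileLoss_le h.ae_mem (min_le_left τ (1 - τ)) (min_le_right _ _) e e'
  rw [h0] at this
  have : 0 < min τ (1 - τ) * (e' - e) ^ 2 := mul_pos hm (pow_two_pos_of_ne_zero (sub_ne_zero.2 hne))
  linarith

lemma IsHull.exists_expectile_eq (h : IsHull η a b) {τ : ℝ} (hτ : τ ∈ Ioo (0 : ℝ) 1) :
    expectile η τ ∈ Icc a b ∧
      τ * upperMoment η (expectile η τ) = (1 - τ) * lowerMoment η (expectile η τ) := by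
  have c1 := continuous_lowerMoment h.ae_mem
  have c2 := continuous_upperMoment h.ae_mem
  have hc : ContinuousOn (fun e => (1 - τ) * lowerMoment η e - τ * upperMoment η e) (Icc a b) := by
    fun_prop
  have h0 : (0 : ℝ) ∈ Icc ((1 - τ) * lowerMoment η a - τ * upperMoment η a)
      ((1 - τ) * lowerMoment η b - τ * upperMoment η b) := by
    rw [h.lowerMoment_left, h.upperMoment_right]
    constructor
    · nlinarith [upperMoment_nonneg (η := η) a, hτ.1]
    · nlinarith [lowerMoment_nonneg (η := η) b, hτ.2]
  obtain ⟨e, he, h0⟩ := intermediate_value_Icc h.le hc h0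
  have h0' : τ * upperMoment η e = (1 - τ) * lowerMoment η e := by
    dsimp at h0; linarith
  rw [h.expectile_eq he hτ h0']
  exact ⟨he, h0'⟩

lemma IsHull.expectile_zero (h : IsHull η a b) : expectile η 0 = a := by
  refine h.expectile_eq_of_forall_lt ⟨le_rfl, h.le⟩ fun e he hne => ?_
  have hlt : a < e := lt_of_le_of_ne he.1 hne.symm
  have h1 : expectileLoss η 0 a = 0 := by
    rw [expectileLoss]
    refine integral_eq_zero_of_ae ?_
    filter_upwards [h.ae_mem] with z hz
    simp only [Pi.zero_apply]
    split_ifs with hz'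
    · simp
    · rw [le_antisymm (not_lt.1 hz') hz.1]; simp
  rw [h1]
  have h2 : ∀ z : ℝ, 0 ≤ (if e < z then (0 : ℝ) else 1 - 0) * (z - e) ^ 2 := fun z => by
    split_ifs <;> positivity
  rw [expectileLoss, integral_pos_iff_support_of_nonneg h2 (integrable_expectileLoss h.ae_mem 0 e)]
  refine (h.pos_Iio e hlt).trans_le (measure_mono fun z hz => ?_)
  have hz : z < e := hz
  rw [Function.mem_support, if_neg hz.not_gt]
  have : z - e ≠ 0 := by linarith
  simpa using this

/-- For τ > 1 the loss need not be convex and the first-order condition is of no use. The integrands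
are compared pointwise instead: for z ≤ b the candidate b has weight 1 - τ ≤ 0 on the largest
possible square. -/
lemma IsHull.expectile_of_one_le (h : IsHull η a b) {τ : ℝ} (hτ : 1 ≤ τ) : expectile η τ = b := by
  refine h.expectile_eq_of_forall_lt ⟨h.le, le_rfl⟩ fun e he hne => ?_
  have hlt : e < b := lt_of_le_of_ne he.2 hne
  have hi := integrable_expectileLoss h.ae_mem τ
  rw [← sub_pos, expectileLoss, expectileLoss, ← integral_sub (hi e) (hi b),
    integral_pos_iff_support_of_nonneg_ae (f := fun z => (if e < z then τ else 1 - τ) * (z - e) ^ 2 -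
      (if b < z then τ else 1 - τ) * (z - b) ^ 2) ?_ ((hi e).sub (hi b))]
  · have h1 := h.pos_Ioi e hlt
    have h3 : η (Ioi e \ Icc a b) = 0 := measure_mono_null (fun z hz => hz.2) h.ae_mem
    rw [← measure_inter_add_sdiff (Ioi e) (measurableSet_Icc (a := a) (b := b)), h3,
      add_zero] at h1
    refine h1.trans_le (measure_mono ?_)
    rintro z ⟨hz : e < z, hz'⟩
    rw [Function.mem_support, if_pos hz, if_neg (not_lt.2 hz'.2)]
    have h2 : 0 < (z - e) ^ 2 := by have := sub_pos.2 hz; positivity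
    nlinarith [sq_nonneg (z - b)]
  · filter_upwards [h.ae_mem] with z hz
    simp only [Pi.zero_apply]
    rw [if_neg (not_lt.2 hz.2)]
    split_ifs with hz'
    · nlinarith [sq_nonneg (z - b), sq_nonneg (z - e)]
    · have : (z - e) ^ 2 ≤ (z - b) ^ 2 := by nlinarith [hz.2, hlt, not_lt.1 hz']
      nlinarith

lemma IsHull.expectile_mem (h : IsHull η a b) {τ : ℝ} (hτ : 0 ≤ τ) : expectile η τ ∈ Icc a b := by
  rcases hτ.eq_or_lt with rfl | h0
  · rw [h.expectile_zero]; exact ⟨le_rfl, h.le⟩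
  · rcases lt_or_ge τ 1 with h1 | h1
    · exact (h.exists_expectile_eq ⟨h0, h1⟩).1
    · rw [h.expectile_of_one_le h1]; exact ⟨h.le, le_rfl⟩

/-- (1 - τ) U - τ V is nondecreasing and vanishes at the expectile of an interior level; the levels
0 and 1 are checked by hand. -/
lemma IsHull.le_of_lt_expectile (h : IsHull η a b) {τ e : ℝ} (hτ : τ ∈ Icc (0 : ℝ) 1)
    (he : e ∈ Icc a b) (hlt : e ≤ expectile η τ) :
    (1 - τ) * lowerMoment η e ≤ τ * upperMoment η e := by
  rcases hτ.1.eq_or_lt with rfl | h0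
  · rw [h.expectile_zero] at hlt
    rw [le_antisymm hlt he.1, h.lowerMoment_left]; simp
  rcases hτ.2.eq_or_lt with rfl | h1
  · simpa using upperMoment_nonneg e
  have h2 := (h.exists_expectile_eq ⟨h0, h1⟩).2
  nlinarith [lowerMoment_mono h.ae_mem hlt, upperMoment_anti h.ae_mem hlt]

lemma IsHull.le_of_expectile_lt (h : IsHull η a b) {τ e : ℝ} (hτ : τ ∈ Ioo (0 : ℝ) 1)
    (hlt : expectile η τ ≤ e) :
    τ * upperMoment η e ≤ (1 - τ) * lowerMoment η e := by
  have h2 := (h.exists_expectile_eq hτ).2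
  nlinarith [lowerMoment_mono h.ae_mem hlt, upperMoment_anti h.ae_mem hlt, hτ.1, hτ.2]

lemma IsHull.moment_pos (h : IsHull η a b) (hab : a < b) (x : ℝ) :
    0 < lowerMoment η x + upperMoment η x := by
  rcases lt_or_ge a x with hx | hx
  · linarith [h.lowerMoment_pos hx, upperMoment_nonneg (η := η) x]
  · linarith [h.upperMoment_pos (hx.trans_lt hab), lowerMoment_nonneg (η := η) x]

/-- The first-order condition puts the expectile of level U / (U + V) at x, with the quotient 0 or 1
at the ends of the hull. Any level whose expectile reaches x satisfies (1 - τ) U ≤ τ V, which gives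
minimality. -/
lemma IsHull.expectileInv_eq (h : IsHull η a b) (hab : a < b) {x : ℝ} (hx : x ∈ Icc a b) :
    expectileInv η x = lowerMoment η x / (lowerMoment η x + upperMoment η x) := by
  have hU := lowerMoment_nonneg (η := η) x
  have hV := upperMoment_nonneg (η := η) x
  have hUV := h.moment_pos hab x
  refine IsLeast.csInf_eq ⟨⟨⟨by positivity, ?_⟩, ?_⟩, ?_⟩
  · rw [div_le_one hUV]; linarith
  · rcases hx.1.eq_or_lt with rfl | hax
    · rw [h.lowerMoment_left, zero_div, h.expectile_zero]
    rcases hx.2.eq_or_lt with rfl | hxb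
    · rw [h.upperMoment_right, add_zero, div_self (h.lowerMoment_pos hax).ne',
        h.expectile_of_one_le le_rfl]
    have hU := h.lowerMoment_pos hax
    have hV := h.upperMoment_pos hxb
    refine (h.expectile_eq hx ⟨by positivity, ?_⟩ ?_).ge
    · rw [div_lt_one hUV]; linarith
    · field_simp; ring
  · rintro τ ⟨hτ, hle⟩
    have := h.le_of_lt_expectile hτ hx hle
    rw [div_le_iff₀ hUV]
    linarith

end Expectile

/-! ### Quantiles and the displacement of the mapped expectiles -/

/-- Right continuity of the distribution function puts the infimum in the set; 0 < τ < 1 makes the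
set nonempty and bounded below, so `sInf` is not a default value. -/
lemma quantile_le_iff {η : Measure ℝ} {τ t : ℝ} (hτ : τ ∈ Ioo (0 : ℝ) 1) :
    quantile η τ ≤ t ↔ τ ≤ cdf η t := by
  have hbdd : BddBelow {x : ℝ | τ ≤ cdf η x} := by
    obtain ⟨y, hy⟩ := ((tendsto_cdf_atBot η).eventually (gt_mem_nhds hτ.1)).exists
    refine ⟨y, fun x hx => ?_⟩
    by_contra! hlt
    exact absurd (hx.trans (monotone_cdf η hlt.le)) (not_le.2 hy)
  have hne : {x : ℝ | τ ≤ cdf η x}.Nonempty := by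
    obtain ⟨y, hy⟩ := ((tendsto_cdf_atTop η).eventually (lt_mem_nhds hτ.2)).exists
    exact ⟨y, hy.le⟩
  constructor
  · intro h
    refine le_trans ?_ (monotone_cdf η h)
    have hc : Tendsto (cdf η) (𝓝[>] quantile η τ) (𝓝 (cdf η (quantile η τ))) :=
      ((cdf η).right_continuous _).tendsto.mono_left (nhdsWithin_mono _ Ioi_subset_Ici_self)
    refine ge_of_tendsto hc ?_
    filter_upwards [self_mem_nhdsWithin] with y hy
    obtain ⟨x, hx, hxy⟩ := exists_lt_of_csInf_lt hne hy
    exact le_trans hx (monotone_cdf η hxy.le)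
  · exact fun h => csInf_le hbdd h

section Quantile

variable {η : Measure ℝ} [IsProbabilityMeasure η]

lemma le_real_Iic_quantile {τ : ℝ} (hτ : τ ∈ Ioo (0 : ℝ) 1) :
    τ ≤ η.real (Iic (quantile η τ)) := by
  rw [← cdf_eq_real]
  exact (quantile_le_iff hτ).1 le_rfl

lemma real_Iio_quantile_le {τ : ℝ} (hτ : τ ∈ Ioo (0 : ℝ) 1) :
    η.real (Iio (quantile η τ)) ≤ τ := by
  have h := (cdf η).measure_Iio (tendsto_cdf_atBot η) (quantile η τ)
  rw [measure_cdf, sub_zero] at h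
  rw [measureReal_def, h]
  refine ENNReal.toReal_le_of_le_ofReal hτ.1.le (ENNReal.ofReal_le_ofReal ?_)
  refine le_of_tendsto ((monotone_cdf η).tendsto_leftLim _) ?_
  filter_upwards [self_mem_nhdsWithin] with y hy
  by_contra! hlt
  exact absurd ((quantile_le_iff hτ).2 hlt.le) (not_le.2 hy)

lemma le_real_Ici_quantile {τ : ℝ} (hτ : τ ∈ Ioo (0 : ℝ) 1) :
    1 - τ ≤ η.real (Ici (quantile η τ)) := by
  have h := probReal_compl_eq_one_sub (μ := η) (measurableSet_Iio (a := quantile η τ))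
  rw [compl_Iio] at h
  linarith [real_Iio_quantile_le (η := η) hτ]

lemma real_Ioi_quantile_le {τ : ℝ} (hτ : τ ∈ Ioo (0 : ℝ) 1) :
    η.real (Ioi (quantile η τ)) ≤ 1 - τ := by
  have h := probReal_compl_eq_one_sub (μ := η) (measurableSet_Iic (a := quantile η τ))
  rw [compl_Iic] at h
  linarith [le_real_Iic_quantile (η := η) hτ]

lemma cdf_eq_zero_of_lt {a b t : ℝ} (h : ∀ᵐ z ∂η, z ∈ Icc a b) (ht : t < a) : cdf η t = 0 := by
  rw [cdf_eq_real, measureReal_def, measure_mono_null (t := (Icc a b)ᶜ), ENNReal.toReal_zero]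
  · intro z hz hz'
    exact absurd (hz'.1.trans hz) (not_le.2 ht)
  · exact h

lemma cdf_eq_one_of_le {a b t : ℝ} (h : ∀ᵐ z ∂η, z ∈ Icc a b) (ht : b ≤ t) : cdf η t = 1 := by
  have h0 : η (Iic t)ᶜ = 0 := measure_mono_null (t := (Icc a b)ᶜ)
    (fun z hz hz' => hz (hz'.2.trans ht)) h
  rw [cdf_eq_real, measureReal_def, (prob_compl_eq_zero_iff measurableSet_Iic).1 h0,
    ENNReal.toReal_one]

lemma quantile_mem {a b τ : ℝ} (h : ∀ᵐ z ∂η, z ∈ Icc a b) (hτ : τ ∈ Ioo (0 : ℝ) 1) :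
    quantile η τ ∈ Icc a b := by
  constructor
  · by_contra! hlt
    have := (quantile_le_iff (η := η) hτ).1 le_rfl
    rw [cdf_eq_zero_of_lt h hlt] at this
    exact absurd hτ.1 (not_lt.2 this)
  · rw [quantile_le_iff hτ, cdf_eq_one_of_le h le_rfl]
    exact hτ.2.le

lemma lowerMoment_quantile_le {a b τ : ℝ} (h : ∀ᵐ z ∂η, z ∈ Icc a b) (hτ : τ ∈ Ioo (0 : ℝ) 1) :
    lowerMoment η (quantile η τ) ≤ τ * (b - a) := by
  have hq := quantile_mem h hτ
  refine (lowerMoment_le_mul h hq).trans ?_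
  exact mul_le_mul_of_nonneg_right (real_Iio_quantile_le hτ) (by linarith [hq.1, hq.2])

lemma upperMoment_quantile_le {a b τ : ℝ} (h : ∀ᵐ z ∂η, z ∈ Icc a b) (hτ : τ ∈ Ioo (0 : ℝ) 1) :
    upperMoment η (quantile η τ) ≤ (1 - τ) * (b - a) := by
  have hq := quantile_mem h hτ
  refine (upperMoment_le_mul h hq).trans ?_
  exact mul_le_mul_of_nonneg_right (real_Ioi_quantile_le hτ) (by linarith [hq.1, hq.2])

end Quantile

/-! ### Rounding of the level and displacement from the quantile -/

lemma level_mem {K k : ℕ} (hk : k ∈ Finset.Icc 1 K) : level K k ∈ Ioo (0 : ℝ) 1 := by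
  obtain ⟨h1, h2⟩ := Finset.mem_Icc.1 hk
  have h1' : (1 : ℝ) ≤ k := by exact_mod_cast h1
  have h2' : (k : ℝ) ≤ K := by exact_mod_cast h2
  unfold level
  constructor
  · apply div_pos <;> linarith
  · rw [div_lt_one (by linarith)]; linarith

/-- The expectile level `(2 ⌊K m⌋ + 1) / (2K)`. -/
def roundedLevel (K : ℕ) (m : ℝ) : ℝ := (2 * (⌊(K : ℝ) * m⌋ : ℝ) + 1) / (2 * (K : ℝ))

/-- Besides being within 1/(2K) of m, the rounded level is at least m/2 and, for m < 1, its
complement is at least (1 - m)/2, whatever K. At m = 1 the floor is K and the level exceeds 1, where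
the expectile is the right end. -/
lemma roundedLevel_bounds {K : ℕ} (hK : 1 ≤ K) {m : ℝ} (hm : m ∈ Icc (0 : ℝ) 1) :
    0 < roundedLevel K m ∧ roundedLevel K m ≤ m + 1 / (2 * K) ∧
      m - 1 / (2 * K) ≤ roundedLevel K m ∧ m / 2 ≤ roundedLevel K m ∧
      (m < 1 → roundedLevel K m < 1 ∧ (1 - m) / 2 ≤ 1 - roundedLevel K m) ∧
      (m = 1 → 1 ≤ roundedLevel K m) := by
  have hK' : (1 : ℝ) ≤ K := by exact_mod_cast hK
  have hK0 : (0 : ℝ) < K := by linarith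
  have h1 := Int.floor_le ((K : ℝ) * m)
  have h2 := Int.lt_floor_add_one ((K : ℝ) * m)
  have h0 : (0 : ℝ) ≤ (⌊(K : ℝ) * m⌋ : ℝ) := by
    exact_mod_cast Int.floor_nonneg.2 (mul_nonneg hK0.le hm.1)
  unfold roundedLevel
  set f : ℝ := (⌊(K : ℝ) * m⌋ : ℝ) with hf
  refine ⟨by positivity, ?_, ?_, ?_, fun hm1 => ?_, fun hm1 => ?_⟩
  · rw [div_le_iff₀ (by positivity)]; field_simp; linarith
  · rw [le_div_iff₀ (by positivity)]; field_simp; linarith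
  · rw [le_div_iff₀ (by positivity)]; linarith
  · have h3 : f + 1 ≤ K := by
      have : ⌊(K : ℝ) * m⌋ < (K : ℤ) := by
        rw [Int.floor_lt]; push_cast; nlinarith
      rw [hf]
      exact_mod_cast Int.add_one_le_iff.2 this
    constructor
    · rw [div_lt_one (by positivity)]; linarith
    · rw [le_sub_comm, div_le_iff₀ (by positivity)]; linarith
  · subst hm1
    have : f = K := by rw [hf, mul_one]; simp
    rw [this, le_div_iff₀ (by positivity)]; linarith

/-- Unprimed moments are taken at the quantile, primed ones at distance ε from it; m is the exact
level, l the rounded one, and `hl` says that the expectile of level l lies at or beyond the shifted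
point. Cross-multiplying with m = U / (U + V) gives U'V ≤ UV' + δL², and V' ≤ V leaves (U' - U) V ≤
δL². The second conclusion rests on `hl2` instead of δ: a jump by ε is impossible where U and V are
both small. Stated for bare numbers so as to serve both directions. -/
lemma displacement_bound {U V U' V' l m δ f ε L : ℝ} (hU : 0 ≤ U) (hV : 0 < V) (hU' : 0 ≤ U')
    (hV' : 0 ≤ V') (hVV : V' ≤ V) (hf : f * ε ≤ U' - U) (hε : U' - U + V - V' = ε)
    (hl : (1 - l) * U' ≤ l * V') (hm : m * (U + V) = U) (hlm : l ≤ m + δ)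
    (hl2 : (1 - m) / 2 ≤ 1 - l) (hδ : 0 ≤ δ) (hL : U + V ≤ L) (hL' : U' + V' ≤ L) :
    f * ε * V ≤ δ * L ^ 2 ∧ ε ≤ 2 * (U + V) := by
  have hUV : 0 < U + V := by linarith
  have hUV' : 0 ≤ U' + V' := by linarith
  constructor
  · have h1 : U' ≤ (m + δ) * (U' + V') := by nlinarith
    have h2 : U' * (U + V) ≤ U * (U' + V') + δ * ((U + V) * (U' + V')) := by
      calc U' * (U + V) ≤ (m + δ) * (U' + V') * (U + V) := mul_le_mul_of_nonneg_right h1 hUV.le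
        _ = (m * (U + V)) * (U' + V') + δ * ((U + V) * (U' + V')) := by ring
        _ = _ := by rw [hm]
    have h3 : (U + V) * (U' + V') ≤ L ^ 2 := by
      rw [sq]; exact mul_le_mul hL hL' hUV' (by linarith)
    have h4 : δ * ((U + V) * (U' + V')) ≤ δ * L ^ 2 := mul_le_mul_of_nonneg_left h3 hδ
    have h5 : f * ε * V ≤ (U' - U) * V := mul_le_mul_of_nonneg_right hf hV.le
    nlinarith [mul_le_mul_of_nonneg_left hVV hU]
  · have h1 : (1 - m) * (U' + V') ≤ 2 * V' := by nlinarith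
    have h2 : V * (U' + V') ≤ 2 * V' * (U + V) := by
      calc V * (U' + V') = (1 - m) * (U' + V') * (U + V) := by
            have : (1 - m) * (U + V) = V := by linarith
            linear_combination (-(U' + V')) * this
        _ ≤ _ := mul_le_mul_of_nonneg_right h1 hUV.le
    have h3 : V * (U' + V) ≤ V * (2 * (U + V)) := by
      nlinarith [mul_nonneg hUV.le (sub_nonneg.2 hVV), mul_nonneg hV.le (sub_nonneg.2 hVV)]
    have h4 := le_of_mul_le_mul_left h3 hV
    linarith

lemma IsHull.Icc_subset {η : Measure ℝ} {a b : ℝ} (h : IsHull η a b) {a' b' : ℝ} (h' : ∀ᵐ z ∂η, z ∈ Icc a' b') :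
    Icc a b ⊆ Icc a' b' := by
  rw [← h.convexHull_eq]
  exact convexHull_min (support_subset_Icc h') (convex_Icc _ _)

section Displacement

variable {η : Measure ℝ} [IsProbabilityMeasure η] {a b : ℝ} {K k : ℕ}

lemma mappedExpectile_eq (K k : ℕ) (η : Measure ℝ) :
    mappedExpectile K k η = expectile η (roundedLevel K (mapper η (level K k))) := rfl

lemma mapper_nonneg (η : Measure ℝ) (τ : ℝ) : 0 ≤ mapper η τ :=
  Real.sInf_nonneg fun _ hx => hx.1.1

lemma IsHull.mappedExpectile_mem (h : IsHull η a b) (K k : ℕ) :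
    mappedExpectile K k η ∈ Icc a b := by
  rw [mappedExpectile_eq]
  refine h.expectile_mem ?_
  have : (0 : ℝ) ≤ ⌊(K : ℝ) * mapper η (level K k)⌋ := by
    exact_mod_cast Int.floor_nonneg.2 (mul_nonneg K.cast_nonneg (mapper_nonneg η _))
  unfold roundedLevel
  positivity

lemma IsHull.mapper_spec (h : IsHull η a b) (hab : a < b) {τ : ℝ} (hτ : τ ∈ Ioo (0 : ℝ) 1) :
    mapper η τ * (lowerMoment η (quantile η τ) + upperMoment η (quantile η τ)) =
      lowerMoment η (quantile η τ) := by
  rw [mapper, h.expectileInv_eq hab (quantile_mem h.ae_mem hτ),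
    div_mul_cancel₀ _ (h.moment_pos hab _).ne']

lemma IsHull.mapper_le_one (h : IsHull η a b) (hab : a < b) {τ : ℝ} (hτ : τ ∈ Ioo (0 : ℝ) 1) :
    mapper η τ ≤ 1 := by
  have h1 := h.mapper_spec hab hτ
  have h2 := h.moment_pos hab (quantile η τ)
  have h3 := upperMoment_nonneg (η := η) (quantile η τ)
  by_contra! hlt
  nlinarith

lemma IsHull.of_lt_mappedExpectile (h : IsHull η a b) (hk : k ∈ Finset.Icc 1 K) {ε L : ℝ}
    (hε : 0 < ε) (hL : b - a ≤ L)
    (hlt : quantile η (level K k) + ε < mappedExpectile K k η) :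
    level K k * ε * upperMoment η (quantile η (level K k)) ≤ 1 / (2 * K) * L ^ 2 ∧
      ε ≤ 2 * (lowerMoment η (quantile η (level K k)) +
        upperMoment η (quantile η (level K k))) := by
  have hτ := level_mem hk
  have hq := quantile_mem h.ae_mem hτ
  have hs := h.mappedExpectile_mem K k
  have hab : a < b := by linarith [hq.1, hs.2]
  have hK : 1 ≤ K := (Finset.mem_Icc.1 hk).1.trans (Finset.mem_Icc.1 hk).2
  have hspec := h.mapper_spec hab hτ
  have hm1 := h.mapper_le_one hab hτ
  have hm0 := mapper_nonneg η (level K k)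
  have hF := le_real_Iic_quantile (η := η) hτ
  rw [mappedExpectile_eq] at hlt hs
  obtain ⟨hl0, hlu, -, -, hl1, -⟩ := roundedLevel_bounds hK ⟨hm0, hm1⟩
  set x := quantile η (level K k)
  set m := mapper η (level K k)
  have hV : 0 < upperMoment η x := h.upperMoment_pos (by linarith [hs.2])
  have hU := lowerMoment_nonneg (η := η) x
  have hm1' : m < 1 := by
    by_contra! hge
    nlinarith
  obtain ⟨hl1, hl2⟩ := hl1 hm1'
  have he : x + ε ∈ Icc a b := ⟨by linarith [hq.1], by linarith [hs.2]⟩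
  have hxe : x ≤ x + ε := by linarith
  have hsub := le_lowerMoment_sub h.ae_mem hxe
  refine displacement_bound hU hV (lowerMoment_nonneg _)
    (upperMoment_nonneg (x + ε)) (upperMoment_anti h.ae_mem hxe) ?_ ?_
    (h.le_of_lt_expectile ⟨hl0.le, hl1.le⟩ he hlt.le) hspec hlu hl2 (by positivity)
    ((lowerMoment_add_upperMoment_le h.ae_mem hq).trans hL)
    ((lowerMoment_add_upperMoment_le h.ae_mem he).trans hL)
  · nlinarith
  · linarith [lowerMoment_sub_upperMoment h.ae_mem x (x + ε)]

lemma IsHull.of_mappedExpectile_lt (h : IsHull η a b) (hk : k ∈ Finset.Icc 1 K) {ε L : ℝ}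
    (hε : 0 < ε) (hL : b - a ≤ L)
    (hlt : mappedExpectile K k η < quantile η (level K k) - ε) :
    (1 - level K k) * ε * lowerMoment η (quantile η (level K k)) ≤ 1 / (2 * K) * L ^ 2 ∧
      ε ≤ 2 * (lowerMoment η (quantile η (level K k)) +
        upperMoment η (quantile η (level K k))) := by
  have hτ := level_mem hk
  have hq := quantile_mem h.ae_mem hτ
  have hs := h.mappedExpectile_mem K k
  have hab : a < b := by linarith [hq.2, hs.1]
  have hK : 1 ≤ K := (Finset.mem_Icc.1 hk).1.trans (Finset.mem_Icc.1 hk).2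
  have hspec := h.mapper_spec hab hτ
  have hm1 := h.mapper_le_one hab hτ
  have hm0 := mapper_nonneg η (level K k)
  have hF := le_real_Ici_quantile (η := η) hτ
  rw [mappedExpectile_eq] at hlt hs
  obtain ⟨hl0, -, hlu, hl2, hl1, hl3⟩ := roundedLevel_bounds hK ⟨hm0, hm1⟩
  set x := quantile η (level K k)
  set m := mapper η (level K k)
  have hU : 0 < lowerMoment η x := h.lowerMoment_pos (by linarith [hs.1])
  have hV := upperMoment_nonneg (η := η) x
  -- At m = 1 the mapped expectile is the right end b, which is not below the quantile.
  have hm1' : m < 1 := by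
    refine lt_of_le_of_ne hm1 fun hm => ?_
    rw [h.expectile_of_one_le (hl3 hm)] at hlt
    linarith [hq.2]
  obtain ⟨hl1, -⟩ := hl1 hm1'
  have he : x - ε ∈ Icc a b := ⟨by linarith [hs.1], by linarith [hq.2]⟩
  have hxe : x - ε ≤ x := by linarith
  have hsub := le_upperMoment_sub h.ae_mem hxe
  have hle := h.le_of_expectile_lt ⟨hl0, hl1⟩ hlt.le
  -- The reflection z ↦ -z exchanges U with V and each level with its complement.
  have := displacement_bound (l := 1 - roundedLevel K m) (m := 1 - m) (δ := 1 / (2 * (K : ℝ)))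
    (f := 1 - level K k) (ε := ε) (L := L) hV hU
    (upperMoment_nonneg (x - ε)) (lowerMoment_nonneg (η := η) (x - ε))
    (lowerMoment_mono h.ae_mem hxe) (by nlinarith)
    (by linarith [lowerMoment_sub_upperMoment h.ae_mem x (x - ε)]) (by linarith) (by linarith)
    (by linarith) (by linarith) (by positivity)
    (by linarith [lowerMoment_add_upperMoment_le h.ae_mem hq])
    (by linarith [lowerMoment_add_upperMoment_le h.ae_mem he])
  exact ⟨this.1, by linarith [this.2]⟩

end Displacement

/-! ### Uniform control of the projection -/

/-- τ_k ≤ c reads k ≤ Kc + 1/2, so the count is ⌊Kc + 1/2⌋. -/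
lemma abs_card_level_le_sub {K : ℕ} (hK : 1 ≤ K) {c : ℝ} (hc : c ∈ Icc (0 : ℝ) 1) :
    |((Finset.Icc 1 K).filter fun k => level K k ≤ c).card - (K : ℝ) * c| ≤ 1 / 2 := by
  have hK0 : (0 : ℝ) < K := by exact_mod_cast hK
  have h0 : 0 ≤ (K : ℝ) * c + 1 / 2 := by have := mul_nonneg hK0.le hc.1; linarith
  have hle : ⌊(K : ℝ) * c + 1 / 2⌋₊ ≤ K := by
    rw [← Nat.lt_add_one_iff, Nat.floor_lt h0]
    push_cast
    nlinarith [hc.2]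
  have : ((Finset.Icc 1 K).filter fun k => level K k ≤ c) =
      Finset.Icc 1 ⌊(K : ℝ) * c + 1 / 2⌋₊ := by
    ext k
    simp only [Finset.mem_filter, Finset.mem_Icc]
    rw [Nat.le_floor_iff h0, level, div_le_iff₀ (by positivity)]
    constructor
    · rintro ⟨⟨h1, -⟩, h2⟩
      exact ⟨h1, by linarith⟩
    · rintro ⟨h1, h2⟩
      exact ⟨⟨h1, ((Nat.le_floor_iff h0).2 h2).trans hle⟩, by linarith⟩
  rw [this, Nat.card_Icc, Nat.add_sub_cancel, abs_le]
  have h1 := Nat.floor_le h0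
  have h2 := Nat.lt_floor_add_one ((K : ℝ) * c + 1 / 2)
  constructor <;> linarith

lemma eventually_div_lt {c δ : ℝ} (hδ : 0 < δ) : ∀ᶠ K : ℕ in atTop, 1 / (2 * (K : ℝ)) * c < δ := by
  have h : Tendsto (fun K : ℕ => 1 / (2 * (K : ℝ)) * c) atTop (𝓝 (0 * c)) := by
    refine Tendsto.mul_const c ?_
    exact Tendsto.div_atTop tendsto_const_nhds
      (tendsto_natCast_atTop_atTop.const_mul_atTop two_pos)
  rw [zero_mul] at h
  exact h.eventually (gt_mem_nhds hδ)

/-- The mean distance between the mapped expectiles and the quantiles of `η`. -/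
def meanDisplacement (K : ℕ) (η : Measure ℝ) : ℝ :=
  (1 / (K : ℝ)) * ∑ k ∈ Finset.Icc 1 K, |mappedExpectile K k η - quantile η (level K k)|

/-- If `η` charges both ends of an interval that essentially carries it, then for large `K` the
mapped expectiles are close to the quantiles on average, uniformly in `η`. -/
lemma eventually_meanDisplacement_le {ε p L : ℝ} (hε : 0 < ε) (hp : 0 < p) (hL : 0 < L) :
    ∀ᶠ K : ℕ in atTop, ∀ (η : Measure ℝ) (l u : ℝ), IsProbabilityMeasure η →
      (∀ᵐ z ∂η, z ∈ Icc (l - ε) (u + ε)) → u + ε - (l - ε) ≤ L →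
      p ≤ η.real (Iic (l + ε)) → p ≤ η.real (Ici (u - ε)) → meanDisplacement K η ≤ 4 * ε := by
  -- Levels within κ of 0 or 1 are given up: at most 2κK + 1 of them, each displaced by at most L,
  -- which adds at most ε to the mean for large K.
  set κ : ℝ := min (ε / (4 * L)) (1 / 2) with hκ
  have hκ0 : 0 < κ := lt_min (by positivity) (by norm_num)
  have hκL : κ * L ≤ ε / 4 := by
    calc κ * L ≤ ε / (4 * L) * L := mul_le_mul_of_nonneg_right (min_le_left _ _) hL.le
      _ = ε / 4 := by field_simp
  have hκ1 : κ ≤ 1 / 2 := min_le_right _ _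
  filter_upwards [eventually_ge_atTop 1, eventually_div_lt (c := L ^ 2)
    (show 0 < κ * ε ^ 2 * p by positivity), eventually_div_lt (c := 4 * L) hε]
    with K hK hK1 hK2 η l u hη hae huL hlo hhi
  have hK0 : (0 : ℝ) < K := by exact_mod_cast hK
  obtain ⟨a, b, h⟩ := exists_isHull (η := η) ⟨_, _, hae⟩
  have hsub := h.Icc_subset hae
  have hbL : b - a ≤ L := by
    linarith [(hsub ⟨le_rfl, h.le⟩).1, (hsub ⟨h.le, le_rfl⟩).2]
  have key : ∀ k ∈ Finset.Icc 1 K, |mappedExpectile K k η - quantile η (level K k)| ≤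
      3 * ε + (L * (if level K k ≤ κ then 1 else 0) +
        L * (1 - if level K k ≤ 1 - κ then 1 else 0)) := by
    intro k hk
    have hτ := level_mem hk
    have hs := h.mappedExpectile_mem K k
    have hq := quantile_mem h.ae_mem hτ
    have hs' := hsub hs
    have hq' := hsub hq
    have hsq : |mappedExpectile K k η - quantile η (level K k)| ≤ L := by
      rw [abs_le]; constructor <;> linarith [hs.1, hs.2, hq.1, hq.2]
    by_cases h1 : level K k ≤ κ
    · rw [if_pos h1]
      split_ifs <;> linarith
    by_cases h2 : level K k ≤ 1 - κ
    swap
    · rw [if_neg h2]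
      split_ifs
      linarith
    rw [if_neg h1, if_pos h2]
    push Not at h1
    rw [abs_le]
    constructor
    · by_contra! hlt
      -- Near l there is no room, since the mapped expectile stays above l - ε. Further away, the
      -- mass p below l + ε is at distance at least ε from the quantile, so U ≥ pε there.
      by_cases hx : quantile η (level K k) < l + 2 * ε
      · linarith [hs'.1]
      · push Not at hx
        have h3 := (h.of_mappedExpectile_lt hk (ε := 3 * ε) (by positivity) hbL (by linarith)).1
        have h4 : p * ε ≤ lowerMoment η (quantile η (level K k)) := by
          refine le_trans ?_ (mul_le_lowerMoment h.ae_mem (x := l + ε) (by linarith))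
          exact mul_le_mul hlo (by linarith) hε.le measureReal_nonneg
        have h5 : κ * ε * (p * ε) ≤ (1 - level K k) * (3 * ε) *
            lowerMoment η (quantile η (level K k)) :=
          mul_le_mul (mul_le_mul (by linarith) (by linarith) hε.le (by linarith)) h4
            (by positivity) (mul_nonneg (by linarith) (by positivity))
        nlinarith
    · by_contra! hlt
      by_cases hx : u - 2 * ε < quantile η (level K k)
      · linarith [hs'.2]
      · push Not at hx
        have h3 := (h.of_lt_mappedExpectile hk (ε := 3 * ε) (by positivity) hbL (by linarith)).1
        have h4 : p * ε ≤ upperMoment η (quantile η (level K k)) := by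
          refine le_trans ?_ (mul_le_upperMoment h.ae_mem (x := u - ε) (by linarith))
          exact mul_le_mul hhi (by linarith) hε.le measureReal_nonneg
        have h5 : κ * ε * (p * ε) ≤ level K k * (3 * ε) *
            upperMoment η (quantile η (level K k)) :=
          mul_le_mul (mul_le_mul (by linarith) (by linarith) hε.le (by linarith)) h4
            (by positivity) (mul_nonneg (by linarith) (by positivity))
        nlinarith
  have hsum := Finset.sum_le_sum key
  rw [Finset.sum_add_distrib, Finset.sum_add_distrib, Finset.sum_const, ← Finset.mul_sum,
    ← Finset.mul_sum, Finset.sum_sub_distrib, Finset.sum_boole, Finset.sum_boole] at hsum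
  simp only [Finset.sum_const, Nat.card_Icc, Nat.add_sub_cancel, nsmul_eq_mul, mul_one] at hsum
  have c1 := (abs_le.1 (abs_card_level_le_sub hK (c := κ) ⟨hκ0.le, by linarith⟩)).2
  have c2 := (abs_le.1 (abs_card_level_le_sub hK (c := 1 - κ) ⟨by linarith, by linarith⟩)).1
  have c3 : 2 * L < ε * K := by
    have : 1 / (2 * (K : ℝ)) * (4 * L) = 2 * L / K := by field_simp; ring
    rwa [this, div_lt_iff₀ hK0] at hK2
  rw [meanDisplacement, one_div, inv_mul_le_iff₀ hK0]
  nlinarith [mul_le_mul_of_nonneg_left c1 hL.le, mul_le_mul_of_nonneg_left c2 hL.le,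
    mul_le_mul_of_nonneg_left hκL hK0.le]

/-- For large `K` the projection keeps a fixed share of the mass of lower and upper tails. -/
lemma exists_eventually_card_ge {ε p L : ℝ} (hε : 0 < ε) (hp : 0 < p) (hL : 0 < L) :
    ∃ p' : ℝ, 0 < p' ∧ ∀ᶠ K : ℕ in atTop, ∀ (η : Measure ℝ) (a b : ℝ), IsProbabilityMeasure η →
      (∀ᵐ z ∂η, z ∈ Icc a b) → b - a ≤ L → ∀ t,
      (p ≤ η.real (Iic t) →
        p' * K ≤ ((Finset.Icc 1 K).filter fun k => mappedExpectile K k η ≤ t + ε).card) ∧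
      (p ≤ η.real (Ici t) →
        p' * K ≤ ((Finset.Icc 1 K).filter fun k => t - ε ≤ mappedExpectile K k η).card) := by
  -- For levels in (c/2, c] the quantile is at most t and U ≤ cL ≤ ε/4. A jump up by ε would force V
  -- ≥ ε/4 through ε ≤ 2(U + V), against τ_k ε V ≤ L²/(2K) for large K. The upper tail uses levels
  -- in (1 - c, 1 - c/2].
  set c : ℝ := min p (min (ε / (4 * L)) (1 / 2)) with hc
  have hc0 : 0 < c := lt_min hp (lt_min (by positivity) (by norm_num))
  have hcp : c ≤ p := min_le_left _ _
  have hcL : c * L ≤ ε / 4 := by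
    calc c * L ≤ ε / (4 * L) * L := mul_le_mul_of_nonneg_right
          ((min_le_right _ _).trans (min_le_left _ _)) hL.le
      _ = ε / 4 := by field_simp
  have hc1 : c ≤ 1 / 2 := (min_le_right _ _).trans (min_le_right _ _)
  refine ⟨c / 4, by positivity, ?_⟩
  filter_upwards [eventually_ge_atTop 1, eventually_div_lt (c := L ^ 2)
    (show 0 < c / 2 * ε * (ε / 4) by positivity), eventually_div_lt (c := 8) hc0]
    with K hK hK1 hK2 η a' b' hη hae hbL' t
  have hK0 : (0 : ℝ) < K := by exact_mod_cast hK
  have c3 : 4 < c * K := by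
    have : 1 / (2 * (K : ℝ)) * 8 = 4 / K := by field_simp; ring
    rwa [this, div_lt_iff₀ hK0] at hK2
  obtain ⟨a, b, h⟩ := exists_isHull (η := η) ⟨_, _, hae⟩
  have hsub := h.Icc_subset hae
  have hbL : b - a ≤ L := by
    linarith [(hsub ⟨le_rfl, h.le⟩).1, (hsub ⟨h.le, le_rfl⟩).2]
  -- Such an interval of length c/2 contains at least cK/2 - 1 levels; `c3` absorbs the 1.
  have count : ∀ {x y : ℝ}, 0 ≤ x → x ≤ y → y ≤ 1 → y - x = c / 2 → ∀ P : ℕ → Prop,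
      ∀ [DecidablePred P],
      (∀ k ∈ Finset.Icc 1 K, x < level K k → level K k ≤ y → P k) →
      c / 4 * K ≤ ((Finset.Icc 1 K).filter P).card := by
    intro x y hx hxy hy hyx P _ hP
    have hss : ((Finset.Icc 1 K).filter fun k => level K k ≤ y) ⊆
        ((Finset.Icc 1 K).filter fun k => level K k ≤ x) ∪ ((Finset.Icc 1 K).filter P) := by
      intro k hk
      rw [Finset.mem_filter] at hk
      rw [Finset.mem_union, Finset.mem_filter, Finset.mem_filter]
      rcases le_or_gt (level K k) x with hkx | hkx
      · exact Or.inl ⟨hk.1, hkx⟩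
      · exact Or.inr ⟨hk.1, hP k hk.1 hkx hk.2⟩
    have hcard := (Finset.card_le_card hss).trans (Finset.card_union_le _ _)
    have hcard' : (((Finset.Icc 1 K).filter fun k => level K k ≤ y).card : ℝ) ≤
        ((Finset.Icc 1 K).filter fun k => level K k ≤ x).card +
          ((Finset.Icc 1 K).filter P).card := by exact_mod_cast hcard
    have c1 := (abs_le.1 (abs_card_level_le_sub hK (c := x) ⟨hx, by linarith⟩)).2
    have c2 := (abs_le.1 (abs_card_level_le_sub hK (c := y) ⟨by linarith, hy⟩)).1
    have : (K : ℝ) * y - K * x = K * (c / 2) := by rw [← hyx]; ring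
    linarith
  constructor
  · intro hpt
    refine count (x := c / 2) (y := c) (by linarith) (by linarith) (by linarith) (by ring) _ ?_
    intro k hk h1 h2
    have hτ := level_mem hk
    have hqt : quantile η (level K k) ≤ t := by
      rw [quantile_le_iff hτ, cdf_eq_real]; linarith
    by_contra! hlt
    obtain ⟨h3, h4⟩ := h.of_lt_mappedExpectile hk hε hbL (by linarith)
    have hU := lowerMoment_quantile_le h.ae_mem hτ
    have hU' : level K k * (b - a) ≤ c * L :=
      mul_le_mul h2 hbL (by linarith [h.le]) hc0.le
    have h5 : c / 2 * ε * (ε / 4) ≤ level K k * ε * upperMoment η (quantile η (level K k)) :=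
      mul_le_mul (mul_le_mul_of_nonneg_right h1.le hε.le) (by linarith) (by positivity)
        (mul_nonneg hτ.1.le hε.le)
    linarith
  · intro hpt
    refine count (x := 1 - c) (y := 1 - c / 2) (by linarith) (by linarith) (by linarith)
      (by ring) _ ?_
    intro k hk h1 h2
    have hτ := level_mem hk
    have hqt : t ≤ quantile η (level K k) := by
      by_contra! hlt
      have h6 := le_real_Iic_quantile (η := η) hτ
      have h7 := probReal_compl_eq_one_sub (μ := η) (measurableSet_Ici (a := t))
      rw [compl_Ici] at h7
      have h8 : η.real (Iic (quantile η (level K k))) ≤ η.real (Iio t) :=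
        measureReal_mono (Iic_subset_Iio.2 hlt)
      linarith
    by_contra! hlt
    obtain ⟨h3, h4⟩ := h.of_mappedExpectile_lt hk hε hbL (by linarith)
    have hV := upperMoment_quantile_le h.ae_mem hτ
    have hV' : (1 - level K k) * (b - a) ≤ c * L :=
      mul_le_mul (by linarith) hbL (by linarith [h.le]) hc0.le
    have h5 : c / 2 * ε * (ε / 4) ≤
        (1 - level K k) * ε * lowerMoment η (quantile η (level K k)) :=
      mul_le_mul (mul_le_mul_of_nonneg_right (by linarith) hε.le) (by linarith) (by positivity)
        (mul_nonneg (by linarith [hτ.2]) hε.le)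
    linarith

/-! ### The distance between distribution functions -/

/-- The Wasserstein-1 distance of two laws, in terms of their distribution functions. -/
def cdfDist (η ν : Measure ℝ) : ℝ≥0∞ := ∫⁻ t, ENNReal.ofReal |cdf η t - cdf ν t|

@[fun_prop]
lemma measurable_cdf (η : Measure ℝ) : Measurable (cdf η) := (monotone_cdf η).measurable

lemma cdfDist_comm (η ν : Measure ℝ) : cdfDist η ν = cdfDist ν η := by
  simp only [cdfDist, abs_sub_comm]

lemma cdfDist_triangle (η ν ρ : Measure ℝ) : cdfDist η ρ ≤ cdfDist η ν + cdfDist ν ρ := by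
  rw [cdfDist, cdfDist, cdfDist, ← lintegral_add_left (by fun_prop)]
  refine lintegral_mono fun t => ?_
  rw [← ENNReal.ofReal_add (abs_nonneg _) (abs_nonneg _)]
  exact ENNReal.ofReal_le_ofReal (abs_sub_le _ _ _)

lemma lintegral_indicator_Ico (a b : ℝ) (c : ℝ≥0∞) :
    ∫⁻ t, (Ico a b).indicator (fun _ => c) t = c * ENNReal.ofReal (b - a) := by
  rw [lintegral_indicator measurableSet_Ico, setLIntegral_const, Real.volume_Ico]

lemma cdfDist_le {η ν : Measure ℝ} [IsProbabilityMeasure η] [IsProbabilityMeasure ν] {a b : ℝ}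
    (hη : ∀ᵐ z ∂η, z ∈ Icc a b) (hν : ∀ᵐ z ∂ν, z ∈ Icc a b) :
    cdfDist η ν ≤ ENNReal.ofReal (b - a) := by
  have h := lintegral_indicator_Ico a b 1
  rw [one_mul] at h
  rw [← h]
  refine lintegral_mono fun t => ?_
  by_cases ht : t ∈ Ico a b
  · rw [indicator_of_mem ht, ← ENNReal.ofReal_one]
    refine ENNReal.ofReal_le_ofReal ?_
    rw [abs_le]
    constructor <;>
      linarith [cdf_nonneg η t, cdf_nonneg ν t, cdf_le_one η t, cdf_le_one ν t]
  · rw [indicator_of_notMem ht]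
    rcases lt_or_ge t a with hta | hta
    · simp [cdf_eq_zero_of_lt hη hta, cdf_eq_zero_of_lt hν hta]
    · have htb : b ≤ t := by by_contra! hlt; exact ht ⟨hta, hlt⟩
      simp [cdf_eq_one_of_le hη htb, cdf_eq_one_of_le hν htb]

lemma lintegral_abs_step_sub (s s' : ℝ) :
    ∫⁻ t, ENNReal.ofReal |(if s ≤ t then (1 : ℝ) else 0) - if s' ≤ t then 1 else 0| =
      ENNReal.ofReal |s - s'| := by
  wlog hss : s ≤ s' generalizing s s'
  · rw [abs_sub_comm, ← this s' s (le_of_not_ge hss)]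
    simp_rw [abs_sub_comm]
  have h := lintegral_indicator_Ico s s' 1
  rw [one_mul] at h
  rw [abs_sub_comm, abs_of_nonneg (sub_nonneg.2 hss), ← h]
  congr 1
  ext t
  by_cases h1 : s ≤ t <;> by_cases h2 : s' ≤ t
  · rw [indicator_of_notMem (fun h => absurd h.2 (not_lt.2 h2))]; simp [h1, h2]
  · rw [indicator_of_mem (show t ∈ Ico s s' from ⟨h1, not_le.1 h2⟩)]; simp [h1, h2]
  · exact absurd (hss.trans h2) h1
  · rw [indicator_of_notMem (fun h => h1 h.1)]; simp [h1, h2]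

lemma measurable_step (s : ℝ) : Measurable fun t : ℝ => if s ≤ t then (1 : ℝ) else 0 :=
  Measurable.ite measurableSet_Ici measurable_const measurable_const

/-- Layer-cake form, which brings sums over atoms and distances of distribution functions under one
integral in t. -/
lemma ofReal_sum_abs_sub_eq (I : Finset ℕ) (s s' : ℕ → ℝ) :
    ENNReal.ofReal (∑ k ∈ I, |s k - s' k|) =
      ∫⁻ t, ENNReal.ofReal (∑ k ∈ I,
        |(if s k ≤ t then (1 : ℝ) else 0) - if s' k ≤ t then 1 else 0|) := by
  rw [ENNReal.ofReal_sum_of_nonneg fun _ _ => abs_nonneg _]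
  simp_rw [ENNReal.ofReal_sum_of_nonneg fun _ _ => abs_nonneg _]
  rw [lintegral_finsetSum]
  · simp_rw [lintegral_abs_step_sub]
  · intro k _
    have := measurable_step (s k)
    have := measurable_step (s' k)
    fun_prop

/-! ### Mean distance of quantiles and the Wasserstein distance -/

section Quantiles

variable {η ν : Measure ℝ} {a b : ℝ} {K : ℕ}

lemma sum_step_quantile (η : Measure ℝ) (t : ℝ) :
    ∑ k ∈ Finset.Icc 1 K, (if quantile η (level K k) ≤ t then (1 : ℝ) else 0) =
      ((Finset.Icc 1 K).filter fun k => level K k ≤ cdf η t).card := by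
  rw [Finset.sum_boole]
  congr 2
  refine Finset.filter_congr fun k hk => ?_
  rw [quantile_le_iff (level_mem hk)]

lemma abs_sum_step_quantile_sub_le (hK : 1 ≤ K) (η : Measure ℝ) (t : ℝ) :
    |∑ k ∈ Finset.Icc 1 K, (if quantile η (level K k) ≤ t then (1 : ℝ) else 0) -
      K * cdf η t| ≤ 1 / 2 := by
  rw [sum_step_quantile]
  exact abs_card_level_le_sub hK ⟨cdf_nonneg η t, cdf_le_one η t⟩

/-- Both indicators test τ_k against a threshold, F_η(t) or F_ν(t), so for fixed t all differences
have the same sign and the triangle inequality is an equality. -/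
lemma sum_abs_step_quantile_sub (η ν : Measure ℝ) (t : ℝ) :
    ∑ k ∈ Finset.Icc 1 K, |(if quantile η (level K k) ≤ t then (1 : ℝ) else 0) -
        if quantile ν (level K k) ≤ t then 1 else 0| =
      |∑ k ∈ Finset.Icc 1 K, (if quantile η (level K k) ≤ t then (1 : ℝ) else 0) -
        ∑ k ∈ Finset.Icc 1 K, (if quantile ν (level K k) ≤ t then (1 : ℝ) else 0)| := by
  wlog h : cdf ν t ≤ cdf η t generalizing η ν
  · rw [abs_sub_comm, ← this ν η (le_of_not_ge h)]
    simp_rw [abs_sub_comm]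
  have h0 : ∀ k ∈ Finset.Icc 1 K, 0 ≤ (if quantile η (level K k) ≤ t then (1 : ℝ) else 0) -
        if quantile ν (level K k) ≤ t then 1 else 0 := by
    intro k hk
    rw [sub_nonneg]
    simp_rw [quantile_le_iff (level_mem hk)]
    split_ifs with h1 h2
    · exact le_rfl
    · exact absurd (h1.trans h) h2
    · exact zero_le_one
    · exact le_rfl
  rw [← Finset.sum_sub_distrib, abs_of_nonneg (Finset.sum_nonneg h0)]
  exact Finset.sum_congr rfl fun k hk => abs_of_nonneg (h0 k hk)

lemma step_eq_of_notMem {a b x y t : ℝ} (hx : x ∈ Icc a b) (hy : y ∈ Icc a b) (ht : t ∉ Ico a b) :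
    (if x ≤ t then (1 : ℝ) else 0) = if y ≤ t then 1 else 0 := by
  rcases lt_or_ge t a with hta | hta
  · rw [if_neg (by linarith [hx.1]), if_neg (by linarith [hy.1])]
  · have htb : b ≤ t := by by_contra! hlt; exact ht ⟨hta, hlt⟩
    rw [if_pos (by linarith [hx.2]), if_pos (by linarith [hy.2])]

/-- At each t the number of quantiles up to t is K F(t) within 1/2, so the two counts differ by at
most K|F_η - F_ν| + 1, and the 1 is paid only on [a, b). -/
lemma sum_abs_quantile_sub_le [IsProbabilityMeasure η] [IsProbabilityMeasure ν] (hK : 1 ≤ K)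
    (hη : ∀ᵐ z ∂η, z ∈ Icc a b) (hν : ∀ᵐ z ∂ν, z ∈ Icc a b) :
    ENNReal.ofReal (∑ k ∈ Finset.Icc 1 K, |quantile η (level K k) - quantile ν (level K k)|) ≤
      K * cdfDist η ν + ENNReal.ofReal (b - a) := by
  have h := lintegral_indicator_Ico a b 1
  rw [one_mul] at h
  rw [ofReal_sum_abs_sub_eq, cdfDist, ← h, ← lintegral_const_mul _ (by fun_prop),
    ← lintegral_add_left (by fun_prop)]
  refine lintegral_mono fun t => ?_
  by_cases ht : t ∈ Ico a b
  · rw [indicator_of_mem ht, ← ENNReal.ofReal_one, ← ENNReal.ofReal_natCast,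
      ← ENNReal.ofReal_mul K.cast_nonneg, ← ENNReal.ofReal_add (by positivity) zero_le_one,
      sum_abs_step_quantile_sub]
    refine ENNReal.ofReal_le_ofReal ?_
    have h1 := abs_le.1 (abs_sum_step_quantile_sub_le hK η t)
    have h2 := abs_le.1 (abs_sum_step_quantile_sub_le hK ν t)
    have h3 : |(K : ℝ) * cdf η t - K * cdf ν t| = K * |cdf η t - cdf ν t| := by
      rw [← mul_sub, abs_mul, abs_of_nonneg K.cast_nonneg]
    have h4 := abs_le.1 h3.le
    rw [abs_le]
    constructor <;> linarith
  · rw [Finset.sum_eq_zero, ENNReal.ofReal_zero]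
    · exact zero_le
    · intro k hk
      rw [step_eq_of_notMem (quantile_mem hη (level_mem hk)) (quantile_mem hν (level_mem hk)) ht,
        sub_self, abs_zero]

end Quantiles

/-! ### The projection -/

section Projection

variable {η : Measure ℝ} {a b : ℝ} {K : ℕ}

lemma mappedProjection_apply (K : ℕ) (η : Measure ℝ) {s : Set ℝ} [DecidablePred (· ∈ s)]
    (hs : MeasurableSet s) :
    mappedProjection K η s =
      (K : ℝ≥0∞)⁻¹ * ((Finset.Icc 1 K).filter fun k => mappedExpectile K k η ∈ s).card := by
  rw [mappedProjection, Measure.smul_apply, Measure.finsetSum_apply, smul_eq_mul,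
    ← Finset.sum_boole]
  congr 1
  refine Finset.sum_congr rfl fun k _ => ?_
  rw [Measure.dirac_apply' _ hs, indicator_apply]
  rfl

lemma isProbabilityMeasure_mappedProjection (hK : 1 ≤ K) (η : Measure ℝ) :
    IsProbabilityMeasure (mappedProjection K η) := by
  constructor
  classical
  rw [mappedProjection_apply K η MeasurableSet.univ]
  simp only [mem_univ, Finset.filter_true, Nat.card_Icc, Nat.add_sub_cancel]
  exact ENNReal.inv_mul_cancel (by simpa using (by omega : K ≠ 0)) (ENNReal.natCast_ne_top K)

lemma mappedProjection_real (K : ℕ) (η : Measure ℝ) {s : Set ℝ} [DecidablePred (· ∈ s)]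
    (hs : MeasurableSet s) :
    (mappedProjection K η).real s =
      (K : ℝ)⁻¹ * ((Finset.Icc 1 K).filter fun k => mappedExpectile K k η ∈ s).card := by
  rw [measureReal_def, mappedProjection_apply K η hs]
  simp

lemma ae_mem_mappedProjection [IsProbabilityMeasure η] (K : ℕ) (h : ∀ᵐ z ∂η, z ∈ Icc a b) :
    ∀ᵐ z ∂(mappedProjection K η), z ∈ Icc a b := by
  classical
  obtain ⟨a', b', h'⟩ := exists_isHull (η := η) ⟨_, _, h⟩
  have hsub := h'.Icc_subset h
  change mappedProjection K η (Icc a b)ᶜ = 0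
  rw [mappedProjection_apply K η measurableSet_Icc.compl, Finset.filter_false_of_mem]
  · simp
  · intro k _ hk
    exact hk (hsub (h'.mappedExpectile_mem K k))

/-- The count of quantiles up to t is the intermediate term: its gap to the count of atoms
integrates to the displacement, its gap to K F(t) is at most 1/2 and matters only on [a, b). -/
lemma cdfDist_mappedProjection_le [IsProbabilityMeasure η] (hK : 1 ≤ K)
    (h : ∀ᵐ z ∂η, z ∈ Icc a b) :
    cdfDist (mappedProjection K η) η ≤
      ENNReal.ofReal (meanDisplacement K η + 1 / (2 * K) * (b - a)) := by
  have hK0 : (0 : ℝ) < K := by exact_mod_cast hK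
  obtain ⟨a', b', h'⟩ := exists_isHull (η := η) ⟨_, _, h⟩
  have hsub := h'.Icc_subset h
  have hab : 0 ≤ b - a := by
    have := hsub ⟨le_rfl, h'.le⟩
    linarith [this.1, this.2]
  have := isProbabilityMeasure_mappedProjection hK η
  have hI := lintegral_indicator_Ico a b (ENNReal.ofReal (1 / (2 * K)))
  rw [meanDisplacement, ENNReal.ofReal_add (by positivity) (by positivity),
    ENNReal.ofReal_mul (by positivity), ENNReal.ofReal_mul (p := 1 / (2 * (K : ℝ)))
    (by positivity), ← hI, ofReal_sum_abs_sub_eq, cdfDist,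
    ← lintegral_const_mul', ← lintegral_add_right _ (measurable_const.indicator measurableSet_Ico)]
  rotate_left
  · exact ENNReal.ofReal_ne_top
  refine lintegral_mono fun t => ?_
  have hcdf : cdf (mappedProjection K η) t = (1 / (K : ℝ)) *
      ∑ k ∈ Finset.Icc 1 K, if mappedExpectile K k η ≤ t then (1 : ℝ) else 0 := by
    rw [cdf_eq_real, mappedProjection_real K η measurableSet_Iic, Finset.sum_boole, one_div]
    rfl
  rw [← ENNReal.ofReal_mul (by positivity)]
  have h1 : |∑ k ∈ Finset.Icc 1 K, (if mappedExpectile K k η ≤ t then (1 : ℝ) else 0) -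
      ∑ k ∈ Finset.Icc 1 K, (if quantile η (level K k) ≤ t then (1 : ℝ) else 0)| ≤
      ∑ k ∈ Finset.Icc 1 K, |(if mappedExpectile K k η ≤ t then (1 : ℝ) else 0) -
        if quantile η (level K k) ≤ t then 1 else 0| := by
    rw [← Finset.sum_sub_distrib]
    exact Finset.abs_sum_le_sum_abs _ _
  by_cases ht : t ∈ Ico a b
  · rw [indicator_of_mem ht, ← ENNReal.ofReal_add (by positivity) (by positivity), hcdf]
    refine ENNReal.ofReal_le_ofReal ?_
    have h2 := abs_sum_step_quantile_sub_le hK η t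
    have h3 : 1 / (K : ℝ) * ∑ k ∈ Finset.Icc 1 K,
        (if mappedExpectile K k η ≤ t then (1 : ℝ) else 0) - cdf η t = 1 / (K : ℝ) *
        ((∑ k ∈ Finset.Icc 1 K, (if mappedExpectile K k η ≤ t then (1 : ℝ) else 0) -
      ∑ k ∈ Finset.Icc 1 K, (if quantile η (level K k) ≤ t then (1 : ℝ) else 0)) +
      (∑ k ∈ Finset.Icc 1 K, (if quantile η (level K k) ≤ t then (1 : ℝ) else 0) -
        K * cdf η t)) := by field_simp; ring
    have h4 : 1 / (2 * (K : ℝ)) = 1 / K * (1 / 2) := by field_simp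
    rw [h3, abs_mul, abs_of_nonneg (by positivity), h4, ← mul_add]
    exact mul_le_mul_of_nonneg_left ((abs_add_le _ _).trans (add_le_add h1 h2)) (by positivity)
  · rw [indicator_of_notMem ht, add_zero]
    have hp := ae_mem_mappedProjection K h
    have : cdf (mappedProjection K η) t = cdf η t := by
      rcases lt_or_ge t a with hta | hta
      · rw [cdf_eq_zero_of_lt h hta, cdf_eq_zero_of_lt hp hta]
      · have htb : b ≤ t := by by_contra! hlt; exact ht ⟨hta, hlt⟩
        rw [cdf_eq_one_of_le h htb, cdf_eq_one_of_le hp htb]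
    rw [this, sub_self, abs_zero, ENNReal.ofReal_zero]
    exact zero_le

end Projection

/-! ### The distributional Bellman operator -/

lemma ofReal_abs_toReal_sub_le {a b c : ℝ≥0∞} (ha : a ≠ ⊤) (hb : b ≠ ⊤) (h1 : a ≤ b + c)
    (h2 : b ≤ a + c) : ENNReal.ofReal |a.toReal - b.toReal| ≤ c := by
  rcases eq_or_ne c ⊤ with rfl | hc
  · exact le_top
  refine ENNReal.ofReal_le_of_le_toReal ?_
  have h1' := ENNReal.toReal_mono (ENNReal.add_ne_top.2 ⟨hb, hc⟩) h1
  have h2' := ENNReal.toReal_mono (ENNReal.add_ne_top.2 ⟨ha, hc⟩) h2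
  rw [ENNReal.toReal_add hb hc] at h1'
  rw [ENNReal.toReal_add ha hc] at h2'
  rw [abs_le]
  constructor <;> linarith

lemma lintegral_comp_sub_div {g : ℝ → ℝ≥0∞} (hg : Measurable g) {c : ℝ} (hc : 0 < c) (r : ℝ) :
    ∫⁻ t, g ((t - r) / c) = ENNReal.ofReal c * ∫⁻ t, g t := by
  rw [lintegral_sub_right_eq_self (fun t => g (t / c)) r]
  have h := Real.map_volume_mul_left (inv_ne_zero hc.ne')
  have h2 : ∫⁻ t, g (t / c) = ∫⁻ t, g t ∂(volume.map (c⁻¹ * ·)) := by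
    rw [lintegral_map hg (by fun_prop)]
    simp_rw [div_eq_inv_mul]
  rw [h2, h, lintegral_smul_measure, inv_inv, abs_of_pos hc, smul_eq_mul]

namespace MDP

variable {S A : Type*} [Fintype S] [Fintype A] (M : MDP S A) (π : S → PMF A)

lemma sum_nextPair (x : S × A) : ∑ y, M.nextPair π x y = 1 := by
  rw [← tsum_fintype (L := .unconditional _), PMF.tsum_coe]

variable {M π} {Z Z' : S × A → Measure ℝ}

lemma lintegral_bellman (hZ : ∀ y, IsProbabilityMeasure (Z y)) (x : S × A) {f : ℝ → ℝ≥0∞}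
    (hf : Measurable f) :
    ∫⁻ z, f z ∂(M.bellman π Z x) =
      ∑ y, M.nextPair π x y *
        ∫⁻ r, ∫⁻ z, f (r + M.discount * z) ∂(Z y) ∂(M.reward x : Measure ℝ) := by
  rw [bellman, lintegral_finsetSum_measure]
  refine Finset.sum_congr rfl fun y _ => ?_
  rw [lintegral_smul_measure, smul_eq_mul, lintegral_map hf (by fun_prop),
    lintegral_prod _ (by fun_prop)]

lemma lintegral_bellman_eq_lintegral_sum {Z : S × A → Measure ℝ}
    (hZ : ∀ y, IsProbabilityMeasure (Z y)) (x : S × A) {f : ℝ → ℝ≥0∞} (hf : Measurable f) :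
    ∫⁻ z, f z ∂(M.bellman π Z x) = ∫⁻ r, ∑ y, M.nextPair π x y *
        ∫⁻ z, f (r + M.discount * z) ∂(Z y) ∂(M.reward x : Measure ℝ) := by
  have hm : ∀ y, Measurable fun r : ℝ => ∫⁻ z, f (r + M.discount * z) ∂(Z y) := fun y =>
    Measurable.lintegral_prod_right' (f := fun p : ℝ × ℝ => f (p.1 + M.discount * p.2))
      (by fun_prop)
  rw [lintegral_bellman hZ x hf, lintegral_finsetSum _ fun y _ => (hm y).const_mul _]
  exact Finset.sum_congr rfl fun y _ => (lintegral_const_mul _ (hm y)).symm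

lemma bellman_apply (hZ : ∀ y, IsProbabilityMeasure (Z y)) (x : S × A) {s : Set ℝ}
    (hs : MeasurableSet s) :
    M.bellman π Z x s = ∑ y, M.nextPair π x y *
      ∫⁻ r, Z y {z | r + M.discount * z ∈ s} ∂(M.reward x : Measure ℝ) := by
  rw [← lintegral_indicator_one hs, lintegral_bellman hZ x (measurable_one.indicator hs)]
  refine Finset.sum_congr rfl fun y _ => ?_
  congr 2
  ext r
  have : MeasurableSet {z | r + M.discount * z ∈ s} :=
    (show Measurable fun z => r + M.discount * z by fun_prop) hs
  rw [← lintegral_indicator_one this]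
  rfl

lemma isProbabilityMeasure_bellman (hZ : ∀ y, IsProbabilityMeasure (Z y)) (x : S × A) :
    IsProbabilityMeasure (M.bellman π Z x) := by
  constructor
  rw [bellman_apply hZ x MeasurableSet.univ]
  simp [M.sum_nextPair π x]

lemma isProbabilityMeasure_iterate_bellman {Z : S × A → Measure ℝ}
    (hZ : ∀ y, IsProbabilityMeasure (Z y)) (n : ℕ) (x : S × A) :
    IsProbabilityMeasure ((M.bellman π)^[n] Z x) := by
  induction n generalizing x with
  | zero => exact hZ x
  | succ n ih =>
    rw [Function.iterate_succ_apply']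
    exact isProbabilityMeasure_bellman ih x

lemma ae_mem_bellman (hγ : 0 ≤ M.discount) (hZ : ∀ y, IsProbabilityMeasure (Z y)) (x : S × A)
    {ρ σ a b : ℝ} {l u : S × A → ℝ} (hR : ∀ᵐ r ∂(M.reward x : Measure ℝ), r ∈ Icc ρ σ)
    (hlu : ∀ y, ∀ᵐ z ∂(Z y), z ∈ Icc (l y) (u y))
    (hab : ∀ y, M.nextPair π x y ≠ 0 → a ≤ ρ + M.discount * l y ∧ σ + M.discount * u y ≤ b) :
    ∀ᵐ z ∂(M.bellman π Z x), z ∈ Icc a b := by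
  change M.bellman π Z x (Icc a b)ᶜ = 0
  rw [bellman_apply hZ x measurableSet_Icc.compl]
  refine Finset.sum_eq_zero fun y _ => ?_
  by_cases hy : M.nextPair π x y = 0
  · rw [hy, zero_mul]
  obtain ⟨h1, h2⟩ := hab y hy
  refine mul_eq_zero_of_right _ ?_
  rw [lintegral_eq_zero_of_ae_eq_zero]
  filter_upwards [hR] with r hr
  refine measure_mono_null (t := (Icc (l y) (u y))ᶜ) (fun z hz hz' => hz ?_) (hlu y)
  constructor
  · linarith [hr.1, mul_le_mul_of_nonneg_left hz'.1 hγ]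
  · linarith [hr.2, mul_le_mul_of_nonneg_left hz'.2 hγ]

lemma le_bellman_real (hZ : ∀ y, IsProbabilityMeasure (Z y)) (x y : S × A) {B C D : Set ℝ}
    (hB : MeasurableSet B) (hD : MeasurableSet D)
    (h : ∀ r ∈ B, ∀ z ∈ C, r + M.discount * z ∈ D) :
    (M.nextPair π x y).toReal * ((M.reward x : Measure ℝ).real B * (Z y).real C) ≤
      (M.bellman π Z x).real D := by
  have := isProbabilityMeasure_bellman (M := M) (π := π) hZ x
  rw [measureReal_def, measureReal_def, measureReal_def, ← ENNReal.toReal_mul,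
    ← ENNReal.toReal_mul]
  refine ENNReal.toReal_mono (measure_ne_top _ _) ?_
  rw [bellman_apply hZ x hD]
  refine le_trans ?_ (Finset.single_le_sum (fun _ _ => zero_le) (Finset.mem_univ y))
  gcongr
  rw [mul_comm, ← setLIntegral_const, ← lintegral_indicator hB]
  refine lintegral_mono fun r => ?_
  by_cases hr : r ∈ B
  · rw [indicator_of_mem hr]
    exact measure_mono fun z hz => h r hr z hz
  · rw [indicator_of_notMem hr]
    exact zero_le

lemma bellman_eq_of_discount_eq_zero (hγ : M.discount = 0)
    (hZ : ∀ y, IsProbabilityMeasure (Z y)) (hZ' : ∀ y, IsProbabilityMeasure (Z' y)) (x : S × A) :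
    M.bellman π Z x = M.bellman π Z' x := by
  refine Measure.ext_of_lintegral _ fun f hf => ?_
  rw [lintegral_bellman hZ x hf, lintegral_bellman hZ' x hf]
  simp [hγ]

lemma bellman_Iic_le (hγ : 0 < M.discount) (hZ : ∀ y, IsProbabilityMeasure (Z y))
    (hZ' : ∀ y, IsProbabilityMeasure (Z' y)) (x : S × A) (t : ℝ) :
    M.bellman π Z x (Iic t) ≤ M.bellman π Z' x (Iic t) + ∑ y, M.nextPair π x y *
      ∫⁻ r, ENNReal.ofReal |cdf (Z y) ((t - r) / M.discount) -
        cdf (Z' y) ((t - r) / M.discount)| ∂(M.reward x : Measure ℝ) := by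
  rw [bellman_apply hZ x measurableSet_Iic, bellman_apply hZ' x measurableSet_Iic,
    ← Finset.sum_add_distrib]
  refine Finset.sum_le_sum fun y _ => ?_
  rw [← mul_add, ← lintegral_add_right _ (by fun_prop)]
  gcongr with r
  have hset : {z : ℝ | r + M.discount * z ∈ Iic t} = Iic ((t - r) / M.discount) := by
    ext z
    simp only [mem_ofPred_eq, mem_Iic]
    rw [le_div_iff₀ hγ]
    constructor <;> intro h <;> linarith
  rw [hset, ← ofReal_cdf (μ := Z y), ← ofReal_cdf (μ := Z' y),
    ← ENNReal.ofReal_add (cdf_nonneg _ _) (abs_nonneg _)]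
  refine ENNReal.ofReal_le_ofReal ?_
  linarith [le_abs_self (cdf (Z y) ((t - r) / M.discount) - cdf (Z' y) ((t - r) / M.discount))]

/-- The Bellman operator is a contraction for the Wasserstein-1 distance. -/
lemma cdfDist_bellman_le (hγ : 0 ≤ M.discount) (hZ : ∀ y, IsProbabilityMeasure (Z y))
    (hZ' : ∀ y, IsProbabilityMeasure (Z' y)) (x : S × A) {c : ℝ≥0∞}
    (hc : ∀ y, cdfDist (Z y) (Z' y) ≤ c) :
    cdfDist (M.bellman π Z x) (M.bellman π Z' x) ≤ ENNReal.ofReal M.discount * c := by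
  have i1 := isProbabilityMeasure_bellman (M := M) (π := π) hZ x
  have i2 := isProbabilityMeasure_bellman (M := M) (π := π) hZ' x
  -- The substitution s = (t - r)/γ needs γ > 0; for γ = 0 the operator forgets its argument.
  rcases hγ.eq_or_lt with h0 | hγ
  · rw [bellman_eq_of_discount_eq_zero h0.symm hZ hZ' x]
    simp [cdfDist]
  have hpt : ∀ t, ENNReal.ofReal |cdf (M.bellman π Z x) t - cdf (M.bellman π Z' x) t| ≤
      ∑ y, M.nextPair π x y *
        ∫⁻ r, ENNReal.ofReal |cdf (Z y) ((t - r) / M.discount) -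
          cdf (Z' y) ((t - r) / M.discount)| ∂(M.reward x : Measure ℝ) := by
    intro t
    rw [cdf_eq_real, cdf_eq_real]
    refine ofReal_abs_toReal_sub_le (measure_ne_top _ _) (measure_ne_top _ _)
      (bellman_Iic_le hγ hZ hZ' x t) ?_
    have := bellman_Iic_le (π := π) hγ hZ' hZ x t
    simpa only [abs_sub_comm] using this
  have hmeas : ∀ y, Measurable fun t : ℝ => ∫⁻ r, ENNReal.ofReal
      |cdf (Z y) ((t - r) / M.discount) - cdf (Z' y) ((t - r) / M.discount)|
        ∂(M.reward x : Measure ℝ) := fun y =>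
    Measurable.lintegral_prod_right' (f := fun p : ℝ × ℝ => ENNReal.ofReal
      |cdf (Z y) ((p.1 - p.2) / M.discount) - cdf (Z' y) ((p.1 - p.2) / M.discount)|)
      (by fun_prop)
  calc cdfDist (M.bellman π Z x) (M.bellman π Z' x)
      ≤ ∫⁻ t, ∑ y, M.nextPair π x y *
        ∫⁻ r, ENNReal.ofReal |cdf (Z y) ((t - r) / M.discount) -
          cdf (Z' y) ((t - r) / M.discount)| ∂(M.reward x : Measure ℝ) := lintegral_mono hpt
    _ = ∑ y, M.nextPair π x y * (ENNReal.ofReal M.discount * cdfDist (Z y) (Z' y)) := by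
        rw [lintegral_finsetSum _ fun y _ => (hmeas y).const_mul _]
        refine Finset.sum_congr rfl fun y _ => ?_
        rw [lintegral_const_mul _ (hmeas y), lintegral_lintegral_swap (by fun_prop)]
        congr 1
        have : ∀ r : ℝ, ∫⁻ t, ENNReal.ofReal |cdf (Z y) ((t - r) / M.discount) -
            cdf (Z' y) ((t - r) / M.discount)| =
            ENNReal.ofReal M.discount * cdfDist (Z y) (Z' y) := fun r =>
          lintegral_comp_sub_div (g := fun s => ENNReal.ofReal |cdf (Z y) s - cdf (Z' y) s|)
            (by fun_prop) hγ r
        simp_rw [this]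
        simp
    _ ≤ ∑ y, M.nextPair π x y * (ENNReal.ofReal M.discount * c) := by
        gcongr with y
        exact hc y
    _ = ENNReal.ofReal M.discount * c := by
        rw [← Finset.sum_mul, M.sum_nextPair π x, one_mul]

end MDP

/-! ### Optimal extremal values -/

lemma exists_forall_pos_le {ι : Type*} [Finite ι] {f : ι → ℝ} (hf : ∀ i, 0 < f i) :
    ∃ c > 0, ∀ i, c ≤ f i := by
  rcases isEmpty_or_nonempty ι with h | h
  · exact ⟨1, one_pos, fun i => (h.false i).elim⟩
  · obtain ⟨i, hi⟩ := Finite.exists_min f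
    exact ⟨f i, hf i, hi⟩

lemma exists_forall_le {ι : Type*} [Finite ι] (f : ι → ℝ) : ∃ c > 0, ∀ i, f i ≤ c := by
  rcases isEmpty_or_nonempty ι with h | h
  · exact ⟨1, one_pos, fun i => (h.false i).elim⟩
  · obtain ⟨i, hi⟩ := Finite.exists_max f
    exact ⟨max (f i) 1, by positivity, fun j => (hi j).trans (le_max_left _ _)⟩

/-- Banach's theorem in the sup norm for l ↦ ρ + γ min l, the minimum running over the possible
successors. -/
lemma exists_min_fixedPoint {X : Type*} [Fintype X] {N : X → Finset X} (hN : ∀ x, (N x).Nonempty)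
    (ρ : X → ℝ) {γ : ℝ} (hγ : γ ∈ Ico (0 : ℝ) 1) :
    ∃ l : X → ℝ, ∀ x, (∀ y ∈ N x, l x ≤ ρ x + γ * l y) ∧ ∃ y ∈ N x, l x = ρ x + γ * l y := by
  let f : (X → ℝ) → X → ℝ := fun l x => ρ x + γ * (N x).inf' (hN x) l
  have hle : ∀ (l l' : X → ℝ) x, (N x).inf' (hN x) l ≤ (N x).inf' (hN x) l' + dist l l' := by
    intro l l' x
    obtain ⟨y, hy, hy'⟩ := Finset.exists_mem_eq_inf' (hN x) l'
    rw [hy']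
    refine (Finset.inf'_le l hy).trans ?_
    have := (le_abs_self _).trans (dist_le_pi_dist l l' y)
    linarith
  have hf : ContractingWith ⟨γ, hγ.1⟩ f := by
    refine ⟨by exact_mod_cast hγ.2, LipschitzWith.of_dist_le_mul fun l l' => ?_⟩
    refine (dist_pi_le_iff (mul_nonneg hγ.1 dist_nonneg)).2 fun x => ?_
    have h1 := mul_le_mul_of_nonneg_left (hle l l' x) hγ.1
    have h2 := mul_le_mul_of_nonneg_left (hle l' l x) hγ.1
    rw [dist_comm l' l] at h2
    rw [Real.dist_eq, abs_le]
    simp only [f]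
    constructor <;> linarith
  have hfix := hf.fixedPoint_isFixedPt
  refine ⟨ContractingWith.fixedPoint f hf, fun x => ?_⟩
  have hx := congrFun hfix x
  set l := ContractingWith.fixedPoint f hf
  constructor
  · intro y hy
    rw [← hx]
    exact add_le_add le_rfl (mul_le_mul_of_nonneg_left (Finset.inf'_le l hy) hγ.1)
  · obtain ⟨y, hy, hy'⟩ := Finset.exists_mem_eq_inf' (hN x) l
    exact ⟨y, hy, by rw [← hy']; exact hx.symm⟩

lemma exists_max_fixedPoint {X : Type*} [Fintype X] {N : X → Finset X} (hN : ∀ x, (N x).Nonempty)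
    (σ : X → ℝ) {γ : ℝ} (hγ : γ ∈ Ico (0 : ℝ) 1) :
    ∃ u : X → ℝ, ∀ x, (∀ y ∈ N x, σ x + γ * u y ≤ u x) ∧ ∃ y ∈ N x, u x = σ x + γ * u y := by
  obtain ⟨l, hl⟩ := exists_min_fixedPoint hN (fun x => -σ x) hγ
  refine ⟨fun x => -l x, fun x => ⟨fun y hy => ?_, ?_⟩⟩
  · linarith [(hl x).1 y hy]
  · obtain ⟨y, hy, h⟩ := (hl x).2
    exact ⟨y, hy, by linarith⟩

/-- A property of real numbers that is inherited by larger numbers and passes from `c` to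
`γ c + ε` holds for all positive numbers. -/
lemma forall_pos_of_contraction {G : ℝ → Prop} {γ : ℝ} (hγ : γ ∈ Ico (0 : ℝ) 1)
    (hmono : ∀ c c', c ≤ c' → G c → G c') {c₀ : ℝ} (hc₀ : 0 ≤ c₀) (h₀ : G c₀)
    (hstep : ∀ c, 0 < c → G c → ∀ ε, 0 < ε → G (γ * c + ε)) {ε : ℝ} (hε : 0 < ε) : G ε := by
  have key : ∀ m : ℕ, G (γ ^ m * c₀ + ε / 2) := by
    intro m
    induction m with
    | zero => exact hmono _ _ (by simp; linarith) h₀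
    | succ m ih =>
      -- The slack (1 - γ) ε/2 makes ε/2 the fixed point of the recursion.
      have h := hstep _ (by have := mul_nonneg (pow_nonneg hγ.1 m) hc₀; linarith) ih
        ((1 - γ) * (ε / 2)) (mul_pos (by linarith [hγ.2]) (by linarith))
      convert h using 1
      ring
  have ht : Tendsto (fun m : ℕ => γ ^ m * c₀) atTop (𝓝 (0 * c₀)) :=
    (tendsto_pow_atTop_nhds_zero_of_lt_one hγ.1 hγ.2).mul_const c₀
  rw [zero_mul] at ht
  obtain ⟨m, hm⟩ := (ht.eventually (gt_mem_nhds (half_pos hε))).exists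
  exact hmono _ _ (by linarith) (key m)

namespace MDP

lemma exists_forall_ae_abs_reward_le {S A : Type*} [Finite S] [Finite A] {M : MDP S A}
    (hbdd : ∀ x, HasBoundedSupport (M.reward x : Measure ℝ)) :
    ∃ C > 0, ∀ x, ∀ᵐ r ∂(M.reward x : Measure ℝ), |r| ≤ C := by
  choose a b hab using hbdd
  obtain ⟨C, hC, h⟩ := exists_forall_le fun x => max |a x| |b x|
  refine ⟨C, hC, fun x => ?_⟩
  filter_upwards [hab x] with r hr
  exact (abs_le_max_abs_abs hr.1 hr.2).trans (h x)

end MDP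

/-! ### The return distribution -/

/-- The distance of two laws is at most the expected distance of random variables with these
laws. -/
lemma cdfDist_map_le {Ω : Type*} [MeasurableSpace Ω] {μ : Measure Ω} [IsProbabilityMeasure μ]
    {X Y : Ω → ℝ} (hX : Measurable X) (hY : Measurable Y) :
    cdfDist (μ.map X) (μ.map Y) ≤ ∫⁻ ω, ENNReal.ofReal |X ω - Y ω| ∂μ := by
  have i1 : IsProbabilityMeasure (μ.map X) := Measure.isProbabilityMeasure_map hX.aemeasurable
  have i2 : IsProbabilityMeasure (μ.map Y) := Measure.isProbabilityMeasure_map hY.aemeasurable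
  have hstep : ∀ {Z : Ω → ℝ}, Measurable Z →
      Measurable fun p : Ω × ℝ => if Z p.1 ≤ p.2 then (1 : ℝ) else 0 := fun hZ =>
    Measurable.ite (measurableSet_le (hZ.comp measurable_fst) measurable_snd) measurable_const
      measurable_const
  have hm : Measurable fun p : Ω × ℝ => ENNReal.ofReal
      |(if X p.1 ≤ p.2 then (1 : ℝ) else 0) - if Y p.1 ≤ p.2 then 1 else 0| := by
    have := hstep hX
    have := hstep hY
    fun_prop
  have hle : ∀ {X Y : Ω → ℝ}, Measurable X → Measurable Y → ∀ t,
      μ.map X (Iic t) ≤ μ.map Y (Iic t) + ∫⁻ ω, ENNReal.ofReal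
        |(if X ω ≤ t then (1 : ℝ) else 0) - if Y ω ≤ t then 1 else 0| ∂μ := by
    intro X Y hX hY t
    rw [Measure.map_apply hX measurableSet_Iic, Measure.map_apply hY measurableSet_Iic,
      ← lintegral_indicator_one (hX measurableSet_Iic),
      ← lintegral_indicator_one (hY measurableSet_Iic),
      ← lintegral_add_left (measurable_one.indicator (hY measurableSet_Iic))]
    refine lintegral_mono fun ω => ?_
    by_cases h1 : X ω ≤ t <;> by_cases h2 : Y ω ≤ t <;> simp [indicator, h1, h2]
  calc cdfDist (μ.map X) (μ.map Y)
      ≤ ∫⁻ t, ∫⁻ ω, ENNReal.ofReal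
        |(if X ω ≤ t then (1 : ℝ) else 0) - if Y ω ≤ t then 1 else 0| ∂μ := by
        refine lintegral_mono fun t => ?_
        rw [cdf_eq_real, cdf_eq_real]
        refine ofReal_abs_toReal_sub_le (measure_ne_top _ _) (measure_ne_top _ _)
          (hle hX hY t) ?_
        simpa only [abs_sub_comm] using hle hY hX t
    _ = ∫⁻ ω, ENNReal.ofReal |X ω - Y ω| ∂μ := by
        rw [lintegral_lintegral_swap (f := fun t ω => ENNReal.ofReal
          |(if X ω ≤ t then (1 : ℝ) else 0) - if Y ω ≤ t then 1 else 0|)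
          (hm.comp measurable_swap).aemeasurable]
        simp_rw [lintegral_abs_step_sub]

namespace MDP

section PartialReturn

variable {S A : Type*} {M : MDP S A}

/-- The discounted sum of the first `n` rewards. -/
def partialReturn (M : MDP S A) (n : ℕ) (ω : ℕ → (S × A) × ℝ) : ℝ :=
  ∑ t ∈ Finset.range n, M.discount ^ t * (ω t).2

@[fun_prop]
lemma measurable_partialReturn [MeasurableSpace S] [MeasurableSpace A] (n : ℕ) : Measurable (M.partialReturn n) := by
  unfold partialReturn
  fun_prop

lemma summable_of_abs_le {C : ℝ} (hγ : M.discount ∈ Ico (0 : ℝ) 1) {ω : ℕ → (S × A) × ℝ} (h : ∀ t, |(ω t).2| ≤ C) :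
    Summable fun t => M.discount ^ t * (ω t).2 := by
  refine Summable.of_norm_bounded ((summable_geometric_of_lt_one hγ.1 hγ.2).mul_right C) fun t => ?_
  rw [norm_mul, norm_pow, Real.norm_eq_abs, Real.norm_eq_abs, abs_of_nonneg hγ.1]
  exact mul_le_mul_of_nonneg_left (h t) (pow_nonneg hγ.1 t)

lemma abs_partialReturn_sub_tsum_le {C : ℝ} (hγ : M.discount ∈ Ico (0 : ℝ) 1) {ω : ℕ → (S × A) × ℝ} (h : ∀ t, |(ω t).2| ≤ C) (n : ℕ) :
    |M.partialReturn n ω - ∑' t, M.discount ^ t * (ω t).2| ≤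
      C * M.discount ^ n / (1 - M.discount) := by
  rw [← Real.dist_eq]
  refine dist_le_of_le_geometric_of_tendsto M.discount C hγ.2 (fun m => ?_)
    (summable_of_abs_le hγ h).hasSum.tendsto_sum_nat n
  rw [Finset.sum_range_succ, dist_self_add_right, norm_mul, norm_pow, Real.norm_eq_abs,
    Real.norm_eq_abs, abs_of_nonneg hγ.1, mul_comm]
  exact mul_le_mul_of_nonneg_right (h m) (pow_nonneg hγ.1 m)

end PartialReturn

variable {S A : Type*} [Fintype S] [Fintype A] [MeasurableSpace S] [MeasurableSpace A]
  [DiscreteMeasurableSpace S] [DiscreteMeasurableSpace A] {M : MDP S A} {π : S → PMF A}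

instance (x : S × A) : IsProbabilityMeasure (M.trajectory π x) := by
  unfold trajectory
  infer_instance

lemma lintegral_stepKernel (w : (S × A) × ℝ) {f : (S × A) × ℝ → ℝ≥0∞} (hf : Measurable f) :
    ∫⁻ v, f v ∂(M.stepKernel π w) =
      ∑ y, M.nextPair π w.1 y * ∫⁻ r, f (y, r) ∂(M.reward y : Measure ℝ) := by
  rw [stepKernel, Kernel.comap_apply, Kernel.lintegral_compProd _ _ _ hf, lintegral_fintype]
  refine Finset.sum_congr rfl fun y _ => ?_
  rw [mul_comm]
  congr 1
  exact PMF.toMeasure_apply_singleton _ _ (measurableSet_singleton y)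

lemma lintegral_trajectory_zero (x : S × A) {f : (S × A) × ℝ → ℝ≥0∞} (hf : Measurable f) :
    ∫⁻ ω, f (ω 0) ∂(M.trajectory π x) = ∫⁻ r, f (x, r) ∂(M.reward x : Measure ℝ) := by
  have h0 : ∀ a : (S × A) × ℝ, (MeasurableEquiv.piUnique
      (fun _ : Finset.Iic 0 => (S × A) × ℝ)).symm a ⟨0, Finset.mem_Iic.2 le_rfl⟩ = a := fun _ => rfl
  have hm : Measurable fun ω : ℕ → (S × A) × ℝ => f (ω 0) := by fun_prop
  rw [trajectory, Kernel.trajMeasure, Measure.lintegral_bind (by fun_prop) hm.aemeasurable,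
    lintegral_map (hm.lintegral_kernel) (by fun_prop)]
  have : ∀ a, ∫⁻ ω : ℕ → (S × A) × ℝ, f (ω 0) ∂(Kernel.traj (X := fun _ => (S × A) × ℝ)
      (fun n => (M.stepKernel π).comap (fun h => h ⟨n, Finset.mem_Iic.2 le_rfl⟩)
      (measurable_pi_apply _)) 0 a) = f (a ⟨0, Finset.mem_Iic.2 le_rfl⟩) := by
    intro a
    rw [Kernel.lintegral_traj _ hm]
    simp [Function.updateFinset]
  simp_rw [this, h0]
  rw [lintegral_prod _ hf.aemeasurable, lintegral_dirac]

/-- The one-step Markov property: given the past up to time n, average over the next pair and its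
reward. -/
lemma lintegral_trajectory_succ (x : S × A) (n : ℕ)
    {f : (∀ _ : Finset.Iic n, (S × A) × ℝ) × ((S × A) × ℝ) → ℝ≥0∞} (hf : Measurable f) :
    ∫⁻ ω, f (Preorder.frestrictLe n ω, ω (n + 1)) ∂(M.trajectory π x) =
      ∫⁻ ω, ∑ y, M.nextPair π (ω n).1 y *
        ∫⁻ r, f (Preorder.frestrictLe n ω, (y, r)) ∂(M.reward y : Measure ℝ)
        ∂(M.trajectory π x) := by
  have h := Kernel.map_frestrictLe_trajMeasure_compProd_eq_map_trajMeasure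
    (X := fun _ => (S × A) × ℝ) (μ₀ := (Measure.dirac x).prod (M.reward x : Measure ℝ))
    (κ := fun n => (M.stepKernel π).comap (fun h => h ⟨n, Finset.mem_Iic.2 le_rfl⟩)
      (measurable_pi_apply _)) (a := n)
  have h2 := congrArg (fun μ => ∫⁻ p, f p ∂μ) h
  rw [Measure.lintegral_compProd hf, lintegral_map hf (by fun_prop),
    lintegral_map hf.lintegral_kernel_prod_right' (by fun_prop)] at h2
  rw [trajectory, ← h2]
  refine lintegral_congr fun ω => ?_
  rw [Kernel.comap_apply, lintegral_stepKernel _ (by fun_prop)]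
  rfl

/-- Unrolling T^π: n + 1 rewards are followed by γ^(n+1) times a sample of Z at the next pair. Z is
quantified inside the induction because removing the last reward replaces Z by T^π Z. -/
lemma lintegral_partialReturn (n : ℕ) : ∀ {Z : S × A → Measure ℝ},
    (∀ y, IsProbabilityMeasure (Z y)) → ∀ (x : S × A) {f : ℝ → ℝ≥0∞}, Measurable f →
    ∫⁻ ω, ∑ y, M.nextPair π (ω n).1 y *
        ∫⁻ z, f (M.partialReturn (n + 1) ω + M.discount ^ (n + 1) * z) ∂(Z y)
        ∂(M.trajectory π x) =
      ∫⁻ z, f z ∂((M.bellman π)^[n + 1] Z x) := by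
  have hmeas : ∀ {Z : S × A → Measure ℝ}, (∀ y, IsProbabilityMeasure (Z y)) →
      ∀ {f : ℝ → ℝ≥0∞}, Measurable f → ∀ c d : ℝ,
      Measurable fun p : ℝ × ((S × A) × ℝ) => ∑ y, M.nextPair π p.2.1 y *
        ∫⁻ z, f (p.1 + c * p.2.2 + d * z) ∂(Z y) := by
    intro Z hZ f hf c d
    refine Finset.measurable_sum _ fun y _ => Measurable.mul ?_ ?_
    · exact (Measurable.of_discrete (f := fun w => M.nextPair π w y)).comp
        (measurable_fst.comp measurable_snd)
    · exact Measurable.lintegral_prod_right' (f := fun q : (ℝ × ((S × A) × ℝ)) × ℝ =>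
        f (q.1.1 + c * q.1.2.2 + d * q.2)) (by fun_prop)
  induction n with
  | zero =>
    intro Z hZ x f hf
    have h1 := lintegral_trajectory_zero (M := M) (π := π) x
      ((hmeas hZ hf 1 M.discount).comp (measurable_prodMk_left (x := (0 : ℝ))))
    simp only [Function.comp_def, zero_add, one_mul] at h1
    simp only [zero_add, partialReturn, Finset.sum_range_one, pow_zero, one_mul, pow_one,
      Function.iterate_one]
    rw [h1, lintegral_bellman_eq_lintegral_sum hZ x hf]
  | succ n ih =>
    intro Z hZ x f hf
    let g : (∀ _ : Finset.Iic n, (S × A) × ℝ) → ℝ := fun h =>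
      ∑ i : Finset.Iic n, M.discount ^ (i : ℕ) * (h i).2
    have hg : Measurable g := by fun_prop
    have hgω : ∀ ω : ℕ → (S × A) × ℝ, g (Preorder.frestrictLe n ω) = M.partialReturn (n + 1) ω := by
      intro ω
      simp only [g, Preorder.frestrictLe_apply, partialReturn]
      rw [Finset.sum_coe_sort (Finset.Iic n) fun t => M.discount ^ t * (ω t).2]
      congr 1
      ext t
      simp
    have h1 := lintegral_trajectory_succ (M := M) (π := π) x n
      ((hmeas hZ hf (M.discount ^ (n + 1)) (M.discount ^ (n + 2))).comp
        ((hg.comp measurable_fst).prodMk measurable_snd))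
    simp only [Function.comp_def, hgω] at h1
    have h2 : ∀ ω : ℕ → (S × A) × ℝ, M.partialReturn (n + 1 + 1) ω =
        M.partialReturn (n + 1) ω + M.discount ^ (n + 1) * (ω (n + 1)).2 := fun ω => by
      rw [partialReturn, Finset.sum_range_succ]; rfl
    simp_rw [h2]
    rw [h1, Function.iterate_succ_apply, ← ih (isProbabilityMeasure_bellman hZ) x hf]
    refine lintegral_congr fun ω => Finset.sum_congr rfl fun y _ => ?_
    congr 1
    rw [lintegral_bellman_eq_lintegral_sum hZ y (f := fun z => f (M.partialReturn (n + 1) ω +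
      M.discount ^ (n + 1) * z)) (by fun_prop)]
    refine lintegral_congr fun r => Finset.sum_congr rfl fun y' _ => ?_
    congr 1
    refine lintegral_congr fun z => ?_
    congr 1
    ring

lemma map_partialReturn (n : ℕ) (x : S × A) :
    (M.trajectory π x).map (M.partialReturn (n + 1)) =
      (M.bellman π)^[n + 1] (fun _ => Measure.dirac 0) x := by
  refine Measure.ext_of_lintegral _ fun f hf => ?_
  rw [← lintegral_partialReturn n (fun _ => inferInstance) x hf,
    lintegral_map hf (by fun_prop)]
  refine lintegral_congr fun ω => ?_
  simp only [lintegral_dirac, mul_zero, add_zero]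
  rw [← Finset.sum_mul, M.sum_nextPair π, one_mul]

lemma ae_abs_reward_le {C : ℝ} (hC : ∀ x, ∀ᵐ r ∂(M.reward x : Measure ℝ), |r| ≤ C) (x : S × A) :
    ∀ᵐ ω ∂(M.trajectory π x), ∀ t, |(ω t).2| ≤ C := by
  classical
  rw [ae_all_iff]
  let f : (S × A) × ℝ → ℝ≥0∞ := fun w => if |w.2| ≤ C then 0 else 1
  have hf : Measurable f := Measurable.ite
    (measurableSet_le (by fun_prop) measurable_const) measurable_const measurable_const
  have hR : ∀ y, ∫⁻ r, f (y, r) ∂(M.reward y : Measure ℝ) = 0 := by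
    intro y
    rw [lintegral_eq_zero_of_ae_eq_zero]
    filter_upwards [hC y] with r hr
    simp [f, hr]
  intro t
  have h0 : ∫⁻ ω, f (ω t) ∂(M.trajectory π x) = 0 := by
    cases t with
    | zero => rw [lintegral_trajectory_zero x hf, hR]
    | succ n =>
      exact (lintegral_trajectory_succ x n (hf.comp measurable_snd)).trans (by simp [hR])
  rw [lintegral_eq_zero_iff (by fun_prop)] at h0
  filter_upwards [h0] with ω hω
  by_contra hlt
  simp [f, hlt] at hω

/-! ### The return law under bounded rewards -/

section Bounded

variable {C : ℝ} (hγ : M.discount ∈ Ico (0 : ℝ) 1)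
  (hC : ∀ x, ∀ᵐ r ∂(M.reward x : Measure ℝ), |r| ≤ C)
include hγ hC

lemma aemeasurable_return (x : S × A) :
    AEMeasurable (fun ω => ∑' t, M.discount ^ t * (ω t).2) (M.trajectory π x) := by
  refine aemeasurable_of_tendsto_metrizable_ae' (f := fun n => M.partialReturn n)
    (fun n => (measurable_partialReturn n).aemeasurable) ?_
  filter_upwards [ae_abs_reward_le hC x] with ω hω
  exact (summable_of_abs_le hγ hω).hasSum.tendsto_sum_nat

lemma isProbabilityMeasure_returnLaw (x : S × A) : IsProbabilityMeasure (M.returnLaw π x) :=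
  Measure.isProbabilityMeasure_map (aemeasurable_return hγ hC x)

lemma ae_mem_returnLaw (x : S × A) :
    ∀ᵐ z ∂(M.returnLaw π x), z ∈ Icc (-(C / (1 - M.discount))) (C / (1 - M.discount)) := by
  refine (ae_map_iff (p := (· ∈ Icc (-(C / (1 - M.discount))) (C / (1 - M.discount))))
    (aemeasurable_return hγ hC x) measurableSet_Icc).2 ?_
  filter_upwards [ae_abs_reward_le hC x] with ω hω
  have h := abs_partialReturn_sub_tsum_le hγ hω 0
  rw [partialReturn, Finset.sum_range_zero, zero_sub, abs_neg, pow_zero, mul_one] at h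
  exact abs_le.1 h

lemma cdfDist_iterate_returnLaw_le (n : ℕ) (x : S × A) :
    cdfDist ((M.bellman π)^[n + 1] (fun _ => Measure.dirac 0) x) (M.returnLaw π x) ≤
      ENNReal.ofReal (C * M.discount ^ (n + 1) / (1 - M.discount)) := by
  have hm := aemeasurable_return (π := π) hγ hC x
  rw [← map_partialReturn, returnLaw, Measure.map_congr hm.ae_eq_mk]
  refine (cdfDist_map_le (measurable_partialReturn _) hm.measurable_mk).trans ?_
  calc _ ≤ ∫⁻ _, ENNReal.ofReal (C * M.discount ^ (n + 1) / (1 - M.discount))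
        ∂(M.trajectory π x) := by
        refine lintegral_mono_ae ?_
        filter_upwards [hm.ae_eq_mk, ae_abs_reward_le hC x] with ω h1 h2
        rw [← h1]
        exact ENNReal.ofReal_le_ofReal (abs_partialReturn_sub_tsum_le hγ h2 (n + 1))
    _ = _ := by simp

/-- The return distribution is a fixed point of the Bellman operator. -/
lemma cdfDist_bellman_returnLaw (x : S × A) :
    cdfDist (M.bellman π (M.returnLaw π) x) (M.returnLaw π x) = 0 := by
  have h1 : ∀ n : ℕ, cdfDist (M.bellman π (M.returnLaw π) x) (M.returnLaw π x) ≤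
      ENNReal.ofReal (2 * (C * M.discount ^ (n + 1) / (1 - M.discount))) := by
    intro n
    have hC0 : 0 ≤ C * M.discount ^ (n + 1) / (1 - M.discount) := by
      obtain ⟨r, hr⟩ := (hC x).exists
      have : 0 ≤ C := (abs_nonneg _).trans hr
      exact div_nonneg (mul_nonneg this (pow_nonneg hγ.1 _)) (by linarith [hγ.2])
    -- Both laws are close to the iterate of order n + 2 started at the point mass 0: one by
    -- contraction, the other by truncating the series.
    refine (cdfDist_triangle _ ((M.bellman π)^[n + 1 + 1] (fun _ => Measure.dirac 0) x) _).trans ?_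
    rw [two_mul, ENNReal.ofReal_add hC0 hC0]
    refine add_le_add ?_ ((cdfDist_iterate_returnLaw_le hγ hC (n + 1) x).trans
      (ENNReal.ofReal_le_ofReal ?_))
    · rw [Function.iterate_succ_apply', cdfDist_comm]
      refine (cdfDist_bellman_le hγ.1 (isProbabilityMeasure_iterate_bellman
        (fun _ => inferInstance) _) (isProbabilityMeasure_returnLaw hγ hC) x
        (cdfDist_iterate_returnLaw_le hγ hC n)).trans ?_
      refine mul_le_of_le_one_left zero_le ?_
      exact ENNReal.ofReal_le_one.2 hγ.2.le
    · have : M.discount ^ (n + 1 + 1) ≤ M.discount ^ (n + 1) :=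
        pow_le_pow_of_le_one hγ.1 hγ.2.le (Nat.le_succ _)
      obtain ⟨r, hr⟩ := (hC x).exists
      have hC' : 0 ≤ C := (abs_nonneg _).trans hr
      have : (0 : ℝ) ≤ 1 - M.discount := by linarith [hγ.2]
      gcongr
  have ht : Tendsto (fun n : ℕ => ENNReal.ofReal (2 * (C * M.discount ^ (n + 1) /
      (1 - M.discount)))) atTop (𝓝 (ENNReal.ofReal (2 * (C * 0 / (1 - M.discount))))) := by
    refine ENNReal.tendsto_ofReal (Tendsto.const_mul _ (Tendsto.div_const (Tendsto.const_mul _ ?_) _))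
    exact (tendsto_pow_atTop_nhds_zero_of_lt_one hγ.1 hγ.2).comp (tendsto_add_atTop_nat 1)
  have := ge_of_tendsto' ht h1
  simpa using this

end Bounded

end MDP

/-! ### Convergence of the iterates -/

lemma eventually_of_forall_succ {P Q : ℕ → Prop} (h : ∀ n, P n → Q (n + 1))
    (hP : ∀ᶠ n in atTop, P n) : ∀ᶠ n in atTop, Q n := by
  obtain ⟨N, hN⟩ := eventually_atTop.1 hP
  refine eventually_atTop.2 ⟨N + 1, fun n hn => ?_⟩
  obtain ⟨m, rfl⟩ : ∃ m, n = m + 1 := ⟨n - 1, by omega⟩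
  exact h m (hN m (by omega))

/-- The law `η` charges both ends of `[l, u]` with mass at least `p`, up to a margin `ε`. -/
def ChargesEnds (ε p l u : ℝ) (η : Measure ℝ) : Prop :=
  p ≤ η.real (Iic (l + ε)) ∧ p ≤ η.real (Ici (u - ε))

lemma ChargesEnds.mono {ε ε' p p' l u : ℝ} {η : Measure ℝ} [IsFiniteMeasure η]
    (h : ChargesEnds ε p l u η) (hε : ε ≤ ε') (hp : p' ≤ p) : ChargesEnds ε' p' l u η :=
  ⟨(hp.trans h.1).trans (measureReal_mono (Iic_subset_Iic.2 (by linarith))),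
    (hp.trans h.2).trans (measureReal_mono (Ici_subset_Ici.2 (by linarith)))⟩

namespace MDP

variable {S A : Type*} [Fintype S] [Fintype A]

/-- The functions `l` and `u` are the ends of the supports of the return distributions, described
by the Bellman equations that they satisfy. -/
structure IsExtremal (M : MDP S A) (π : S → PMF A) (ρ σ l u : S × A → ℝ) : Prop where
  isHull : ∀ x, IsHull (M.reward x : Measure ℝ) (ρ x) (σ x)
  le_lower : ∀ x y, M.nextPair π x y ≠ 0 → l x ≤ ρ x + M.discount * l y
  lower_eq : ∀ x, ∃ y, M.nextPair π x y ≠ 0 ∧ l x = ρ x + M.discount * l y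
  upper_le : ∀ x y, M.nextPair π x y ≠ 0 → σ x + M.discount * u y ≤ u x
  upper_eq : ∀ x, ∃ y, M.nextPair π x y ≠ 0 ∧ u x = σ x + M.discount * u y

variable {M : MDP S A} {π : S → PMF A} {ρ σ l u : S × A → ℝ}

lemma exists_isExtremal (hγ : M.discount ∈ Ico (0 : ℝ) 1)
    (hbdd : ∀ x, HasBoundedSupport (M.reward x : Measure ℝ)) (π : S → PMF A) :
    ∃ ρ σ l u, M.IsExtremal π ρ σ l u := by
  classical
  choose ρ σ hR using fun x => exists_isHull (hbdd x)
  let N : S × A → Finset (S × A) := fun x => Finset.univ.filter fun y => M.nextPair π x y ≠ 0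
  have hN : ∀ x, (N x).Nonempty := fun x => by
    obtain ⟨y, hy⟩ := (M.nextPair π x).support_nonempty
    exact ⟨y, by simpa [N] using hy⟩
  obtain ⟨l, hl⟩ := exists_min_fixedPoint hN ρ hγ
  obtain ⟨u, hu⟩ := exists_max_fixedPoint hN σ hγ
  refine ⟨ρ, σ, l, u, hR, fun x y hy => (hl x).1 y (by simpa [N] using hy), fun x => ?_,
    fun x y hy => (hu x).1 y (by simpa [N] using hy), fun x => ?_⟩
  · obtain ⟨y, hy, h⟩ := (hl x).2
    exact ⟨y, by simpa [N] using hy, h⟩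
  · obtain ⟨y, hy, h⟩ := (hu x).2
    exact ⟨y, by simpa [N] using hy, h⟩

lemma IsExtremal.ae_mem_bellman (h : M.IsExtremal π ρ σ l u) (hγ : 0 ≤ M.discount)
    {Z : S × A → Measure ℝ} (hZ : ∀ y, IsProbabilityMeasure (Z y)) {δ : ℝ}
    (hδ : ∀ y, ∀ᵐ z ∂(Z y), z ∈ Icc (l y - δ) (u y + δ)) (x : S × A) :
    ∀ᵐ z ∂(M.bellman π Z x), z ∈ Icc (l x - M.discount * δ) (u x + M.discount * δ) := by
  refine MDP.ae_mem_bellman hγ hZ x (h.isHull x).ae_mem hδ fun y hy => ⟨?_, ?_⟩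
  · linarith [h.le_lower x y hy]
  · linarith [h.upper_le x y hy]

/-- Along the successor y attaining the minimum, a reward within ε of ρ x and an independent sample
below l y + D sum to at most l x + γD + ε; likewise at the top. By finiteness κ, a least positive
transition probability times a least reward mass at the ends, depends on ε but not on Z, D or p. -/
lemma IsExtremal.exists_chargesEnds_bellman (h : M.IsExtremal π ρ σ l u) (hγ : 0 ≤ M.discount)
    {ε : ℝ} (hε : 0 < ε) :
    ∃ κ > 0, ∀ (Z : S × A → Measure ℝ), (∀ y, IsProbabilityMeasure (Z y)) → ∀ D p : ℝ, 0 < p →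
      (∀ y, ChargesEnds D p (l y) (u y) (Z y)) →
      ∀ x, ChargesEnds (M.discount * D + ε) (κ * p) (l x) (u x) (M.bellman π Z x) := by
  classical
  obtain ⟨t, ht0, ht⟩ := exists_forall_pos_le (f := fun q : (S × A) × (S × A) =>
    if M.nextPair π q.1 q.2 ≠ 0 then (M.nextPair π q.1 q.2).toReal else 1) fun q => by
      split_ifs with hq
      · exact ENNReal.toReal_pos hq (PMF.apply_ne_top _ _)
      · exact one_pos
  have ht' : ∀ x y, M.nextPair π x y ≠ 0 → t ≤ (M.nextPair π x y).toReal := fun x y hxy => by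
    have := ht (x, y)
    rwa [if_pos hxy] at this
  obtain ⟨r, hr0, hr⟩ := exists_forall_pos_le (f := fun x : S × A =>
    (M.reward x : Measure ℝ).real (Iic (ρ x + ε))) fun x =>
      ENNReal.toReal_pos (((h.isHull x).pos_Iio (ρ x + ε) (by linarith)).trans_le
        (measure_mono Iio_subset_Iic_self)).ne' (measure_ne_top _ _)
  obtain ⟨r', hr0', hr'⟩ := exists_forall_pos_le (f := fun x : S × A =>
    (M.reward x : Measure ℝ).real (Ici (σ x - ε))) fun x =>
      ENNReal.toReal_pos (((h.isHull x).pos_Ioi (σ x - ε) (by linarith)).trans_le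
        (measure_mono Ioi_subset_Ici_self)).ne' (measure_ne_top _ _)
  refine ⟨t * min r r', by positivity, fun Z hZ D p hp hD x => ⟨?_, ?_⟩⟩
  · obtain ⟨y, hy, hxy⟩ := h.lower_eq x
    refine le_trans ?_ (le_bellman_real hZ x y (B := Iic (ρ x + ε)) (C := Iic (l y + D))
      measurableSet_Iic measurableSet_Iic fun a (ha : a ≤ _) z (hz : z ≤ _) => ?_)
    · rw [mul_assoc]
      exact mul_le_mul (ht' x y hy) (mul_le_mul ((min_le_left _ _).trans (hr x)) (hD y).1 hp.le
        measureReal_nonneg) (by positivity) ENNReal.toReal_nonneg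
    · have := mul_le_mul_of_nonneg_left hz hγ
      rw [mem_Iic]
      linarith
  · obtain ⟨y, hy, hxy⟩ := h.upper_eq x
    refine le_trans ?_ (le_bellman_real hZ x y (B := Ici (σ x - ε)) (C := Ici (u y - D))
      measurableSet_Ici measurableSet_Ici fun a (ha : _ ≤ a) z (hz : _ ≤ z) => ?_)
    · rw [mul_assoc]
      exact mul_le_mul (ht' x y hy) (mul_le_mul ((min_le_right _ _).trans (hr' x)) (hD y).2 hp.le
        measureReal_nonneg) (by positivity) ENNReal.toReal_nonneg
    · have := mul_le_mul_of_nonneg_left hz hγ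
      rw [mem_Ici]
      linarith

/-! ### Supports, mass at the ends and displacement of the iterates -/

section Iterates

variable {Z₀ : ℕ → S × A → Measure ℝ} (hZ₀ : ∀ K x, IsProbabilityMeasure (Z₀ K x))
include hZ₀

lemma isProbabilityMeasure_iterate {K : ℕ} (hK : 1 ≤ K) (n : ℕ) (x : S × A) :
    IsProbabilityMeasure ((M.projectedBellman π K)^[n] (Z₀ K) x) := by
  cases n with
  | zero => exact hZ₀ K x
  | succ n =>
    rw [Function.iterate_succ_apply']
    exact isProbabilityMeasure_mappedProjection hK _

variable (h : M.IsExtremal π ρ σ l u) (hγ : M.discount ∈ Ico (0 : ℝ) 1)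
  (hZ₀bdd : ∀ K x, HasBoundedSupport (Z₀ K x))
include h hγ hZ₀bdd

/-- The Bellman step shrinks the overshoot beyond [l, u] by the factor γ, and the projection stays
within the hull. The number of steps may depend on K through the initial laws. -/
lemma eventually_ae_mem_iterate {K : ℕ} (hK : 1 ≤ K) {δ : ℝ} (hδ : 0 < δ) :
    ∀ᶠ n in atTop, ∀ x, ∀ᵐ z ∂((M.projectedBellman π K)^[n] (Z₀ K) x),
      z ∈ Icc (l x - δ) (u x + δ) := by
  have hmono : ∀ {c c' : ℝ}, c ≤ c' → ∀ {n : ℕ},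
      (∀ x, ∀ᵐ z ∂((M.projectedBellman π K)^[n] (Z₀ K) x), z ∈ Icc (l x - c) (u x + c)) →
      ∀ x, ∀ᵐ z ∂((M.projectedBellman π K)^[n] (Z₀ K) x), z ∈ Icc (l x - c') (u x + c') := by
    intro c c' hcc n hn x
    filter_upwards [hn x] with z hz
    exact ⟨by linarith [hz.1], by linarith [hz.2]⟩
  have hstep : ∀ (c : ℝ) (n : ℕ),
      (∀ x, ∀ᵐ z ∂((M.projectedBellman π K)^[n] (Z₀ K) x), z ∈ Icc (l x - c) (u x + c)) →
      ∀ x, ∀ᵐ z ∂((M.projectedBellman π K)^[n + 1] (Z₀ K) x),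
        z ∈ Icc (l x - M.discount * c) (u x + M.discount * c) := by
    intro c n hn x
    have hp := isProbabilityMeasure_iterate (M := M) (π := π) hZ₀ hK n
    have := isProbabilityMeasure_bellman (M := M) (π := π) hp x
    rw [Function.iterate_succ_apply']
    exact ae_mem_mappedProjection K (h.ae_mem_bellman hγ.1 hp hn x)
  choose a b hab using hZ₀bdd K
  obtain ⟨c, hc, hc'⟩ := exists_forall_le fun x => max (l x - a x) (b x - u x)
  have h0 : ∀ n, ∀ x, ∀ᵐ z ∂((M.projectedBellman π K)^[n] (Z₀ K) x),
      z ∈ Icc (l x - c) (u x + c) := by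
    intro n
    induction n with
    | zero =>
      intro x
      filter_upwards [hab x] with z hz
      have h1 := (le_max_left _ _).trans (hc' x)
      have h2 := (le_max_right _ _).trans (hc' x)
      exact ⟨by linarith [hz.1], by linarith [hz.2]⟩
    | succ n ih => exact hmono (mul_le_of_le_one_left hc.le hγ.2.le) (hstep c n ih)
  refine forall_pos_of_contraction (G := fun δ => ∀ᶠ n in atTop, ∀ x,
    ∀ᵐ z ∂((M.projectedBellman π K)^[n] (Z₀ K) x), z ∈ Icc (l x - δ) (u x + δ)) hγ
    (fun c c' hcc hc => hc.mono fun n => hmono hcc) hc.le (Eventually.of_forall h0)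
    (fun c _ hc ε hε => ?_) hδ
  refine (eventually_of_forall_succ (hstep c) hc).mono fun n => hmono (by linarith)

/-- The margin W exceeds the length of the eventual supports, so at first each end is charged with
mass 1. Each round replaces p by a positive constant fixed before K and n, and the number of rounds
depends only on γ, W and D. -/
lemma exists_eventually_chargesEnds_iterate {D : ℝ} (hD : 0 < D) :
    ∃ p > 0, ∀ᶠ K in atTop, ∀ᶠ n in atTop, ∀ x,
      ChargesEnds D p (l x) (u x) ((M.projectedBellman π K)^[n] (Z₀ K) x) := by
  obtain ⟨W, hW0, hW⟩ := exists_forall_le fun x => u x + 1 - (l x - 1)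
  refine forall_pos_of_contraction (G := fun D => ∃ p > 0, ∀ᶠ K in atTop, ∀ᶠ n in atTop, ∀ x,
    ChargesEnds D p (l x) (u x) ((M.projectedBellman π K)^[n] (Z₀ K) x)) hγ
    (fun c c' hcc hc => ?_) hW0.le ⟨1, one_pos, ?_⟩ (fun c hc0 hc ε hε => ?_) hD
  · obtain ⟨p, hp, hc⟩ := hc
    refine ⟨p, hp, ?_⟩
    filter_upwards [hc, eventually_ge_atTop 1] with K hKc hK
    refine hKc.mono fun n hn x => ?_
    have := isProbabilityMeasure_iterate (M := M) (π := π) hZ₀ hK n x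
    exact (hn x).mono hcc le_rfl
  · filter_upwards [eventually_ge_atTop 1] with K hK
    filter_upwards [eventually_ae_mem_iterate hZ₀ h hγ hZ₀bdd hK one_pos] with n hn x
    have := isProbabilityMeasure_iterate (M := M) (π := π) hZ₀ hK n x
    have hfull : ∀ s : Set ℝ, Icc (l x - 1) (u x + 1) ⊆ s →
        1 ≤ ((M.projectedBellman π K)^[n] (Z₀ K) x).real s := by
      intro s hs
      rw [measureReal_def, measure_congr (t := univ) (s := s) (eventuallyEq_univ.2 ((hn x).mono fun z hz => hs hz)),
        measure_univ, ENNReal.toReal_one]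
    exact ⟨hfull _ fun z hz => by rw [mem_Iic]; linarith [hz.2, hW x],
      hfull _ fun z hz => by rw [mem_Ici]; linarith [hz.1, hW x]⟩
  · obtain ⟨p, hp, hc⟩ := hc
    -- Half of ε is spent in the Bellman step, half in the projection.
    obtain ⟨κ, hκ, hbell⟩ := h.exists_chargesEnds_bellman hγ.1 (half_pos hε)
    obtain ⟨p', hp', hproj⟩ := exists_eventually_card_ge (half_pos hε) (mul_pos hκ hp) hW0
    refine ⟨p', hp', ?_⟩
    filter_upwards [hc, hproj, eventually_ge_atTop 1] with K hKc hKp hK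
    have hK0 : (0 : ℝ) < K := by exact_mod_cast hK
    refine eventually_of_forall_succ (fun n hn => ?_)
      (hKc.and (eventually_ae_mem_iterate hZ₀ h hγ hZ₀bdd hK one_pos))
    intro x
    have hpr := isProbabilityMeasure_iterate (M := M) (π := π) hZ₀ hK n
    have hpb := isProbabilityMeasure_bellman (M := M) (π := π) hpr x
    have hb := hbell _ hpr c p hp hn.1 x
    have hae := h.ae_mem_bellman hγ.1 hpr hn.2 x
    have hlen : u x + M.discount * 1 - (l x - M.discount * 1) ≤ W := by linarith [hW x, hγ.2]
    classical
    rw [Function.iterate_succ_apply', projectedBellman]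
    constructor
    · rw [mappedProjection_real _ _ measurableSet_Iic, inv_mul_eq_div, le_div_iff₀ hK0]
      refine ((hKp _ _ _ hpb hae hlen _).1 hb.1).trans
        (Nat.cast_le.2 (Finset.card_le_card fun k hk => ?_))
      rw [Finset.mem_filter] at hk ⊢
      exact ⟨hk.1, by rw [mem_Iic]; linarith [hk.2]⟩
    · rw [mappedProjection_real _ _ measurableSet_Ici, inv_mul_eq_div, le_div_iff₀ hK0]
      refine ((hKp _ _ _ hpb hae hlen _).2 hb.2).trans
        (Nat.cast_le.2 (Finset.card_le_card fun k hk => ?_))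
      rw [Finset.mem_filter] at hk ⊢
      exact ⟨hk.1, by rw [mem_Ici]; linarith [hk.2]⟩

lemma eventually_meanDisplacement_iterate_le {ε : ℝ} (hε : 0 < ε) :
    ∀ᶠ K in atTop, ∀ᶠ n in atTop, ∀ x,
      meanDisplacement K ((M.projectedBellman π K)^[n] (Z₀ K) x) ≤ ε ∧
      meanDisplacement K (M.bellman π ((M.projectedBellman π K)^[n] (Z₀ K)) x) ≤ ε := by
  obtain ⟨W, hW0, hW⟩ := exists_forall_le fun x => u x + 1 - (l x - 1)
  set δ : ℝ := min (ε / 4) 1 with hδ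
  have hδ0 : 0 < δ := lt_min (by positivity) one_pos
  have hδ1 : δ ≤ 1 := min_le_right _ _
  have hδε : 4 * δ ≤ ε := by linarith [min_le_left (ε / 4) 1]
  have hγδ : M.discount * δ ≤ δ := mul_le_of_le_one_left hδ0.le hγ.2.le
  -- With this slack the Bellman targets keep the margin: γδ + (1 - γ)δ = δ.
  have hη : 0 < (1 - M.discount) * δ := mul_pos (by linarith [hγ.2]) hδ0
  obtain ⟨p, hp, hends⟩ := exists_eventually_chargesEnds_iterate hZ₀ h hγ hZ₀bdd hδ0
  obtain ⟨κ, hκ, hbell⟩ := h.exists_chargesEnds_bellman hγ.1 hη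
  filter_upwards [hends, eventually_ge_atTop 1,
    eventually_meanDisplacement_le hδ0 hp hW0,
    eventually_meanDisplacement_le hδ0 (mul_pos hκ hp) hW0] with K hends hK h1 h2
  filter_upwards [hends, eventually_ae_mem_iterate hZ₀ h hγ hZ₀bdd hK hδ0] with n hn hn' x
  have hpr := isProbabilityMeasure_iterate (M := M) (π := π) hZ₀ hK n
  have hpb := isProbabilityMeasure_bellman (M := M) (π := π) hpr x
  have hlen : u x + δ - (l x - δ) ≤ W := by linarith [hW x]
  constructor
  · exact (h1 _ _ _ (hpr x) (hn' x) hlen (hn x).1 (hn x).2).trans hδε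
  · have hae : ∀ᵐ z ∂(M.bellman π ((M.projectedBellman π K)^[n] (Z₀ K)) x),
        z ∈ Icc (l x - δ) (u x + δ) := by
      filter_upwards [h.ae_mem_bellman hγ.1 hpr hn' x] with z hz
      exact ⟨by linarith [hz.1], by linarith [hz.2]⟩
    have hb := (hbell _ hpr δ p hp hn x).mono (ε' := δ) (by linarith) le_rfl
    exact (h2 _ _ _ hpb hae hlen hb.1 hb.2).trans hδε

end Iterates

/-! ### Convergence to the return law and of the statistics -/

section Limit

variable [MeasurableSpace S] [MeasurableSpace A]
  [DiscreteMeasurableSpace S] [DiscreteMeasurableSpace A]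

/-- Going through the quantiles of both laws, the two displacements cost 2ε and the mean quantile
gap ε + 2B/K < 2ε. -/
lemma statisticsError_le {K : ℕ} (hK : 1 ≤ K) {η : S × A → Measure ℝ}
    (hη : ∀ x, IsProbabilityMeasure (η x)) (hπ : ∀ x, IsProbabilityMeasure (M.returnLaw π x))
    {B ε : ℝ} (hε : 0 < ε) (hB : 0 ≤ B) (hBK : 1 / (2 * (K : ℝ)) * (4 * B) < ε)
    (hηB : ∀ x, ∀ᵐ z ∂(η x), z ∈ Icc (-B) B)
    (hπB : ∀ x, ∀ᵐ z ∂(M.returnLaw π x), z ∈ Icc (-B) B)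
    (hd : ∀ x, cdfDist (η x) (M.returnLaw π x) ≤ ENNReal.ofReal ε)
    (h1 : ∀ x, meanDisplacement K (η x) ≤ ε)
    (h2 : ∀ x, meanDisplacement K (M.returnLaw π x) ≤ ε) :
    M.statisticsError π K (fun k x => mappedExpectile K k (η x)) ≤ ENNReal.ofReal (4 * ε) := by
  have hK0 : (0 : ℝ) < K := by exact_mod_cast hK
  refine iSup_le fun x => ENNReal.ofReal_le_ofReal ?_
  have hq : ∑ k ∈ Finset.Icc 1 K, |quantile (η x) (level K k) -
      quantile (M.returnLaw π x) (level K k)| ≤ K * ε + 2 * B := by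
    have h3 := (sum_abs_quantile_sub_le hK (hηB x) (hπB x)).trans
      (add_le_add (mul_le_mul le_rfl (hd x) zero_le zero_le) le_rfl)
    rw [← ENNReal.ofReal_natCast, ← ENNReal.ofReal_mul hK0.le,
      ← ENNReal.ofReal_add (by positivity) (by linarith),
      ENNReal.ofReal_le_ofReal_iff (by nlinarith)] at h3
    linarith
  have htri : ∀ k ∈ Finset.Icc 1 K,
      |mappedExpectile K k (M.returnLaw π x) - mappedExpectile K k (η x)| ≤
      |mappedExpectile K k (M.returnLaw π x) - quantile (M.returnLaw π x) (level K k)| +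
      |quantile (η x) (level K k) - quantile (M.returnLaw π x) (level K k)| +
      |mappedExpectile K k (η x) - quantile (η x) (level K k)| := by
    intro k _
    have e1 := abs_sub_le (mappedExpectile K k (M.returnLaw π x))
      (quantile (M.returnLaw π x) (level K k)) (mappedExpectile K k (η x))
    have e2 := abs_sub_le (quantile (M.returnLaw π x) (level K k))
      (quantile (η x) (level K k)) (mappedExpectile K k (η x))
    rw [abs_sub_comm (quantile (M.returnLaw π x) (level K k)) (quantile (η x) (level K k)),
      abs_sub_comm (quantile (η x) (level K k)) (mappedExpectile K k (η x))] at e2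
    linarith
  have hsum := mul_le_mul_of_nonneg_left (Finset.sum_le_sum htri)
    (show 0 ≤ 1 / (K : ℝ) by positivity)
  rw [Finset.sum_add_distrib, Finset.sum_add_distrib, mul_add, mul_add] at hsum
  have hq' := mul_le_mul_of_nonneg_left hq (show 0 ≤ 1 / (K : ℝ) by positivity)
  have e1 : 1 / (K : ℝ) * (K * ε + 2 * B) = ε + 1 / (2 * (K : ℝ)) * (4 * B) := by
    field_simp
    ring
  have e2 := h1 x
  have e3 := h2 x
  unfold meanDisplacement at e2 e3
  linarith

variable {Z₀ : ℕ → S × A → Measure ℝ} (hZ₀ : ∀ K x, IsProbabilityMeasure (Z₀ K x))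
  (h : M.IsExtremal π ρ σ l u) (hγ : M.discount ∈ Ico (0 : ℝ) 1)
  (hZ₀bdd : ∀ K x, HasBoundedSupport (Z₀ K x))
  {C : ℝ} (hC : ∀ x, ∀ᵐ r ∂(M.reward x : Measure ℝ), |r| ≤ C)
include hγ hC

lemma cdfDist_bellman_returnLaw_le {Z : S × A → Measure ℝ}
    (hZ : ∀ y, IsProbabilityMeasure (Z y)) {c : ℝ}
    (hc : ∀ y, cdfDist (Z y) (M.returnLaw π y) ≤ ENNReal.ofReal c) (x : S × A) :
    cdfDist (M.bellman π Z x) (M.returnLaw π x) ≤ ENNReal.ofReal (M.discount * c) := by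
  refine (cdfDist_triangle _ (M.bellman π (M.returnLaw π) x) _).trans ?_
  rw [cdfDist_bellman_returnLaw hγ hC, add_zero, ENNReal.ofReal_mul hγ.1]
  exact cdfDist_bellman_le hγ.1 hZ (isProbabilityMeasure_returnLaw hγ hC) x hc

/-- A fixed law charges both ends of its own hull, and there are only finitely many return laws. -/
lemma eventually_meanDisplacement_returnLaw_le {ε : ℝ} (hε : 0 < ε) :
    ∀ᶠ K in atTop, ∀ x, meanDisplacement K (M.returnLaw π x) ≤ ε := by
  rw [eventually_all]
  intro x
  have := isProbabilityMeasure_returnLaw (π := π) hγ hC x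
  obtain ⟨a, b, hab⟩ := exists_isHull ⟨_, _, ae_mem_returnLaw (π := π) hγ hC x⟩
  have h1 : 0 < (M.returnLaw π x).real (Iic (a + ε / 4)) :=
    ENNReal.toReal_pos ((hab.pos_Iio (a + ε / 4) (by linarith)).trans_le
        (measure_mono Iio_subset_Iic_self)).ne' (measure_ne_top _ _)
  have h2 : 0 < (M.returnLaw π x).real (Ici (b - ε / 4)) :=
    ENNReal.toReal_pos ((hab.pos_Ioi (b - ε / 4) (by linarith)).trans_le
        (measure_mono Ioi_subset_Ici_self)).ne' (measure_ne_top _ _)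
  have hle := hab.le
  filter_upwards [eventually_meanDisplacement_le (ε := ε / 4) (by positivity) (lt_min h1 h2)
    (L := b + ε / 4 - (a - ε / 4)) (by linarith)] with K hK
  refine (hK _ a b this ?_ le_rfl (min_le_left _ _) (min_le_right _ _)).trans (by linarith)
  filter_upwards [hab.ae_mem] with z hz
  exact ⟨by linarith [hz.1], by linarith [hz.2]⟩

lemma exists_common_bound (l u : S × A → ℝ) :
    ∃ B > 0, (∀ x, Icc (l x - 1) (u x + 1) ⊆ Icc (-B) B) ∧
      ∀ x, ∀ᵐ z ∂(M.returnLaw π x), z ∈ Icc (-B) B := by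
  obtain ⟨W, hW0, hW⟩ := exists_forall_le fun x => max |l x - 1| |u x + 1|
  let B : ℝ := max W (C / (1 - M.discount))
  have hB0 : 0 < B := hW0.trans_le (le_max_left _ _)
  have hsupp : ∀ x, Icc (l x - 1) (u x + 1) ⊆ Icc (-B) B := fun x => by
    have h1 := ((le_max_left _ _).trans (hW x)).trans (le_max_left W (C / (1 - M.discount)))
    have h2 := ((le_max_right _ _).trans (hW x)).trans (le_max_left W (C / (1 - M.discount)))
    exact Icc_subset_Icc (abs_le.1 h1).1 (abs_le.1 h2).2
  have hret : ∀ x, ∀ᵐ z ∂(M.returnLaw π x), z ∈ Icc (-B) B := fun x => by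
    filter_upwards [ae_mem_returnLaw (π := π) hγ hC x] with z hz
    have := le_max_right W (C / (1 - M.discount))
    exact ⟨by linarith [hz.1], by linarith [hz.2]⟩
  exact ⟨B, hB0, hsupp, hret⟩

include hZ₀ h hZ₀bdd

/-- An error c becomes γc by contraction and gains at most ε from the projection; the recursion
starts at the length of a common interval carrying all the laws. -/
lemma eventually_cdfDist_iterate_le {ε : ℝ} (hε : 0 < ε) :
    ∀ᶠ K in atTop, ∀ᶠ n in atTop, ∀ x,
      cdfDist ((M.projectedBellman π K)^[n] (Z₀ K) x) (M.returnLaw π x) ≤ ENNReal.ofReal ε := by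
  obtain ⟨B, hB0, hsupp, hret⟩ := exists_common_bound (π := π) hγ hC l u
  refine forall_pos_of_contraction (G := fun ε => ∀ᶠ K in atTop, ∀ᶠ n in atTop, ∀ x,
      cdfDist ((M.projectedBellman π K)^[n] (Z₀ K) x) (M.returnLaw π x) ≤ ENNReal.ofReal ε) hγ
    (fun c c' hcc hc => ?_) (c₀ := B - -B) (by linarith) ?_ (fun c hc0 hc ε hε => ?_) hε
  · filter_upwards [hc] with K hK
    filter_upwards [hK] with n hn x
    exact (hn x).trans (ENNReal.ofReal_le_ofReal hcc)
  · filter_upwards [eventually_ge_atTop 1] with K hK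
    filter_upwards [eventually_ae_mem_iterate hZ₀ h hγ hZ₀bdd hK one_pos] with n hn x
    have := isProbabilityMeasure_iterate (M := M) (π := π) hZ₀ hK n x
    have := isProbabilityMeasure_returnLaw (π := π) hγ hC x
    exact cdfDist_le ((hn x).mono fun z hz => hsupp x hz) (hret x)
  · filter_upwards [hc, eventually_ge_atTop 1,
      eventually_meanDisplacement_iterate_le hZ₀ h hγ hZ₀bdd (half_pos hε),
      eventually_div_lt (c := B - -B) (half_pos hε)] with K hKc hK hKm hKd
    refine eventually_of_forall_succ (fun n hn => ?_)
      (hKc.and (hKm.and (eventually_ae_mem_iterate hZ₀ h hγ hZ₀bdd hK one_pos)))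
    intro x
    obtain ⟨hn1, hn2, hn3⟩ := hn
    have hpr := isProbabilityMeasure_iterate (M := M) (π := π) hZ₀ hK n
    have hpb := isProbabilityMeasure_bellman (M := M) (π := π) hpr x
    have hae : ∀ᵐ z ∂(M.bellman π ((M.projectedBellman π K)^[n] (Z₀ K)) x), z ∈ Icc (-B) B := by
      filter_upwards [h.ae_mem_bellman hγ.1 hpr hn3 x] with z hz
      exact hsupp x ⟨by linarith [hz.1, hγ.2], by linarith [hz.2, hγ.2]⟩
    rw [Function.iterate_succ_apply', projectedBellman]
    refine (cdfDist_triangle _ (M.bellman π ((M.projectedBellman π K)^[n] (Z₀ K)) x) _).trans ?_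
    rw [add_comm (M.discount * c), ENNReal.ofReal_add hε.le (mul_nonneg hγ.1 hc0.le)]
    refine add_le_add ((cdfDist_mappedProjection_le hK hae).trans (ENNReal.ofReal_le_ofReal ?_))
      (cdfDist_bellman_returnLaw_le hγ hC hpr hn1 x)
    linarith [(hn2 x).2]

lemma eventually_statisticsError_le {ε : ℝ} (hε : 0 < ε) :
    ∀ᶠ K in atTop, ∀ᶠ n in atTop,
      M.statisticsError π K (fun k x =>
        mappedExpectile K k ((M.projectedBellman π K)^[n] (Z₀ K) x)) ≤ ENNReal.ofReal (4 * ε) ∧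
      M.statisticsError π K (fun k x =>
        mappedExpectile K k (M.bellman π ((M.projectedBellman π K)^[n] (Z₀ K)) x)) ≤
          ENNReal.ofReal (4 * ε) := by
  obtain ⟨B, hB0, hsupp, hret⟩ := exists_common_bound (π := π) hγ hC l u
  have hπ := isProbabilityMeasure_returnLaw (π := π) hγ hC
  filter_upwards [eventually_ge_atTop 1, eventually_div_lt (c := 4 * B) hε,
    eventually_meanDisplacement_iterate_le hZ₀ h hγ hZ₀bdd hε,
    eventually_meanDisplacement_returnLaw_le (π := π) hγ hC hε,
    eventually_cdfDist_iterate_le hZ₀ h hγ hZ₀bdd hC hε] with K hK hKB hKm hKπ hKd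
  filter_upwards [hKm, hKd, eventually_ae_mem_iterate hZ₀ h hγ hZ₀bdd hK one_pos] with n h1 h2 h3
  have hpr := isProbabilityMeasure_iterate (M := M) (π := π) hZ₀ hK n
  constructor
  · exact statisticsError_le hK hpr hπ hε hB0.le hKB
      (fun x => (h3 x).mono fun z hz => hsupp x hz) hret h2 (fun x => (h1 x).1) hKπ
  · refine statisticsError_le hK (isProbabilityMeasure_bellman hpr) hπ hε hB0.le hKB
      (fun x => ?_) hret (fun x => ?_) (fun x => (h1 x).2) hKπ
    · filter_upwards [h.ae_mem_bellman hγ.1 hpr h3 x] with z hz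
      exact hsupp x ⟨by linarith [hz.1, hγ.2], by linarith [hz.2, hγ.2]⟩
    · refine (cdfDist_bellman_returnLaw_le hγ hC hpr h2 x).trans (ENNReal.ofReal_le_ofReal ?_)
      exact mul_le_of_le_one_left hε.le hγ.2.le

end Limit

end MDP

lemma tendsto_limsup_zero {f : ℕ → ℕ → ℝ≥0∞}
    (h : ∀ ε : ℝ, 0 < ε → ∀ᶠ K in atTop, ∀ᶠ n in atTop, f K n ≤ ENNReal.ofReal (4 * ε)) :
    Tendsto (fun K => limsup (f K) atTop) atTop (𝓝 0) := by
  rw [ENNReal.tendsto_nhds_zero]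
  intro ε hε
  obtain ⟨δ, hδ, hδε⟩ := ENNReal.lt_iff_exists_nnreal_btwn.1 hε
  have hδ0 : (0 : ℝ) < δ := by exact_mod_cast hδ
  filter_upwards [h (δ / 4) (by positivity)] with K hK
  refine (limsup_le_of_le (h := hK)).trans ?_
  rw [mul_div_cancel₀ _ (by norm_num : (4 : ℝ) ≠ 0), ENNReal.ofReal_coe_nnreal]
  exact hδε.le

end

theorem theorem1 {S A : Type*} [Fintype S] [Fintype A]
    [MeasurableSpace S] [MeasurableSpace A]
    [DiscreteMeasurableSpace S] [DiscreteMeasurableSpace A]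
    (M : MDP S A) (hγ : M.discount ∈ Ico (0 : ℝ) 1)
    (hbdd : ∀ x, HasBoundedSupport (M.reward x : Measure ℝ))
    (hdisc : ∀ x, HasFinitelyManyDiscontinuities (M.reward x : Measure ℝ))
    (π : S → PMF A)
    (Z₀ : ℕ → S × A → Measure ℝ)
    (hZ₀ : ∀ K x, IsProbabilityMeasure (Z₀ K x))
    (hZ₀bdd : ∀ K x, HasBoundedSupport (Z₀ K x)) :
    -- the statistics of the iterates
    Tendsto (fun K : ℕ => limsup (fun n : ℕ => M.statisticsError π K fun k x =>
        mappedExpectile K k ((M.projectedBellman π K)^[n] (Z₀ K) x)) atTop) atTop (𝓝 0) ∧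
    -- the statistics computed from the Bellman targets, which are the atoms of the next iterate
    Tendsto (fun K : ℕ => limsup (fun n : ℕ => M.statisticsError π K fun k x =>
        mappedExpectile K k (M.bellman π ((M.projectedBellman π K)^[n] (Z₀ K)) x))
        atTop) atTop (𝓝 0) := by
  obtain ⟨ρ, σ, l, u, h⟩ := MDP.exists_isExtremal hγ hbdd π
  obtain ⟨C, -, hC⟩ := MDP.exists_forall_ae_abs_reward_le hbdd
  have key := fun (ε : ℝ) (hε : 0 < ε) =>
    MDP.eventually_statisticsError_le hZ₀ h hγ hZ₀bdd hC hε
  exact ⟨tendsto_limsup_zero fun ε hε => (key ε hε).mono fun K hK => hK.mono fun n hn => hn.1,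
    tendsto_limsup_zero fun ε hε => (key ε hε).mono fun K hK => hK.mono fun n hn => hn.2⟩
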